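/- Model. Base stations (BSs) form a homogeneous Poisson point process (PPP) of intensity $\varphi_b>0$ in $\mathbb R^2$, and users an independent PPP of intensity $\varphi_u>0$. Each user requests packets, drawn from a library $c_1,\dots,c_C$ with popularities $f_1\ge\dots\ge f_C\ge 0$, $\sum_i f_i=1$, at rate $\lambda>0$. A proportion $\alpha\in[0,1)$ of the users are cache-enabled and store the $M\le C$ most popular packets; the others are cache-untenable. Let $\delta=\sum_{i=1}^M f_i$. Time is slotted with slot duration $\tau>0$; all packets have size $T>0$, the bandwidth is $B>0$, and the transmission power is $P>0$. Cell loads. The number $N$ of users of a cell is Poisson with mean $\varphi_u S$ given the cell size $S$, where $S$ has density $\frac{(\varphi_bK)^K}{\Gamma(K)}s^{K-1}e^{-\varphi_bKs}$ on $[0,\infty)$, $K=3.575$. Given $N=n$, the queue length at the BS after slot $k$ satisfies $q_{k+1}=\max(q_k-1,0)+a_{k+1}$ with $q_0=0$ and i.i.d. Poisson arrivals $a_{k+1}$ of mean $\rho_n=(1-\alpha\delta)n\lambda\tau$. Let $p_t=\sum_{n:\rho_n\ge1}\mathbb P(N=n)$ be the probability of a full-load cell, and $p_0=\sum_{n:\rho_n<1}\mathbb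 P(N=n)\lim_{k\to\infty}\mathbb P(q_k=0\mid N=n)$ the probability of a free-load cell. Downlink. A typical cache-untenable user at the origin is served by the nearest BS, at distance $d_0$. Every other BS, at distance $d_k$, is active independently with probability $p_t+(1-p_t)(1-p_0)=1-p_0+p_0p_t$. All channel power gains $|h_k|^2$ are $\exp(1)$ distributed; the gains, the activities and the BS locations are independent. With path-loss exponent $\beta$ and noise power $\sigma^2$, $$\mathrm{SINR}_u=\frac{P|h_0|^2d_0^{-\beta}}{\sum_{k\ge1\text{ active}}P|h_k|^2d_k^{-\beta}+\sigma^2},$$ and the packet loss rate is $\mathcal P_{l,u}(\sigma^2)=\mathbb P\big(\tau B\log_2(1+\mathrm{SINR}_u)<T\big)$, the probability being over both the BS process and the fading. Claim. Let $\beta=4$ and $\bar T=2^{T/(\tau B)}-1$. In the interference-limited regime, $$\mathcal P_{l,u}(0)=\lim_{\sigma^2\downarrow0}\mathcal P_{l,u}(\sigma^2)=\frac{1}{\Big[(1-p_0+p_0p_t)\sqrt{\bar T}\,\arctan\sqrt{\bar T}\Big]^{-1}+1}.$$ -/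

import Mathlib

open MeasureTheory ProbabilityTheory Filter Topology
open scoped ENNReal NNReal

noncomputable section

namespace CacheNet

/-! ### The slotted queue at a base station -/

/-- Law of the number `q k` of requests waiting after slot `k`, for the recursion
`q (k + 1) = max (q k - 1) 0 + a (k + 1)`, where the numbers of arrivals `a (k + 1)` are i.i.d.
Poisson with mean `ρ` per slot (so `a (k + 1)` is independent of `q k`), started empty.
Subtraction in `ℕ` is truncated at `0`. -/
def queueLaw (ρ : ℝ≥0) : ℕ → Measure ℕ
  | 0 => Measure.dirac 0
  | k + 1 => ((queueLaw ρ k).map fun q => q - 1) ∗ poissonMeasure ρ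

/-- Probability that the queue is empty in equilibrium: `lim_k ℙ(q k = 0)`. -/
def emptyProb (ρ : ℝ≥0) : ℝ :=
  limUnder atTop fun k => (queueLaw ρ k).real {0}

instance (ρ : ℝ≥0) (k : ℕ) : IsProbabilityMeasure (queueLaw ρ k) := by
  induction k with
  | zero => rw [queueLaw]; infer_instance
  | succ k ih =>
    rw [queueLaw]
    have : IsProbabilityMeasure ((queueLaw ρ k).map fun q => q - 1) :=
      Measure.isProbabilityMeasure_map (by fun_prop)
    infer_instance

theorem lintegral_queueLaw_succ (ρ : ℝ≥0) (k : ℕ) (f : ℕ → ℝ≥0∞) :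
    ∫⁻ x, f x ∂queueLaw ρ (k + 1)
      = ∫⁻ x, ∫⁻ y, f (x - 1 + y) ∂poissonMeasure ρ ∂queueLaw ρ k := by
  rw [queueLaw, Measure.lintegral_conv (by fun_prop), lintegral_map (by fun_prop) (by fun_prop)]

theorem lintegral_queueLaw_succ_le (ρ : ℝ≥0) (k : ℕ) (f : ℕ → ℝ≥0∞) (hf : Antitone f) :
    ∫⁻ x, f x ∂queueLaw ρ (k + 1) ≤ ∫⁻ x, f x ∂queueLaw ρ k := by
  induction k generalizing f with
  | zero =>
    calc ∫⁻ x, f x ∂queueLaw ρ 1 ≤ ∫⁻ _, f 0 ∂queueLaw ρ 1 :=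
          lintegral_mono fun x => hf (Nat.zero_le x)
      _ = ∫⁻ x, f x ∂queueLaw ρ 0 := by
          rw [lintegral_const, measure_univ, mul_one, queueLaw, lintegral_dirac]
  | succ k ih =>
    rw [lintegral_queueLaw_succ ρ (k + 1) f, lintegral_queueLaw_succ ρ k f]
    refine ih _ fun a b hab => lintegral_mono fun y => hf ?_
    omega

/-- The limit that defines `emptyProb` exists. -/
theorem tendsto_emptyProb (ρ : ℝ≥0) :
    Tendsto (fun k => (queueLaw ρ k).real {0}) atTop (𝓝 (emptyProb ρ)) := by
  have h : Antitone fun k => (queueLaw ρ k).real {0} := by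
    refine antitone_nat_of_succ_le fun k => ?_
    have h1 := lintegral_queueLaw_succ_le ρ k (({0} : Set ℕ).indicator 1) (by
      intro a b hab
      by_cases hb : b = 0
      · have ha : a = 0 := by omega
        simp [ha, hb]
      · simp [hb])
    rw [lintegral_indicator_one (by measurability),
      lintegral_indicator_one (by measurability)] at h1
    exact ENNReal.toReal_mono (measure_ne_top _ _) h1
  exact tendsto_nhds_limUnder
    ⟨_, tendsto_atTop_ciInf h ⟨0, by rintro _ ⟨k, rfl⟩; exact measureReal_nonneg⟩⟩

/-! ### Parameters of the network and load of the cells -/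

/-- Parameters of the cache-enabled network, with their standing ranges. -/
structure Network where
  /-- number of packets in the library -/
  C : ℕ
  /-- number of packets cached at a cache-enabled user -/
  M : ℕ
  /-- popularity distribution of the packets, most popular first -/
  f : Fin C → ℝ
  /-- proportion of cache-enabled users -/
  α : ℝ
  /-- rate of packet requests of one user -/
  reqRate : ℝ
  /-- duration of a slot -/
  τ : ℝ
  /-- bandwidth -/
  B : ℝ
  /-- packet size -/
  T : ℝ
  /-- transmission power of a base station -/
  P : ℝ
  /-- intensity of the base stations -/
  φb : ℝ
  /-- intensity of the users -/
  φu : ℝ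
  M_le : M ≤ C
  f_nonneg : ∀ i, 0 ≤ f i
  f_sum : ∑ i, f i = 1
  f_anti : Antitone f
  α_nonneg : 0 ≤ α
  α_lt : α < 1
  reqRate_pos : 0 < reqRate
  τ_pos : 0 < τ
  B_pos : 0 < B
  T_pos : 0 < T
  P_pos : 0 < P
  φb_pos : 0 < φb
  φu_pos : 0 < φu

namespace Network

variable (𝒩 : Network)

/-- Cache hit ratio `δ = f_1 + ⋯ + f_M`. -/
def hitRatio : ℝ := ∑ i with i.val < 𝒩.M, 𝒩.f i

/-- Mean number of requests per slot that reach the base station of a cell with `n` users,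
`(1 - α δ) n λ τ`. -/
def load (n : ℕ) : ℝ := (1 - 𝒩.α * 𝒩.hitRatio) * n * 𝒩.reqRate * 𝒩.τ

/-- Probability that a cell contains `n` users: the cell size `S` has the Gamma density
`(φ_b K)^K / Γ(K) s^(K-1) exp(-φ_b K s)` with `K = 3.575`, and given `S = s` the number of users
is Poisson with mean `φ_u s`. -/
def userProb (n : ℕ) : ℝ :=
  ∫ s, (poissonMeasure (𝒩.φu * s).toNNReal).real {n} ∂gammaMeasure 3.575 (𝒩.φb * 3.575)

open Classical in
/-- Probability `p_t` of a full-load cell: the queue is not stable. -/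
def fullProb : ℝ := ∑' n : ℕ, if 1 ≤ 𝒩.load n then 𝒩.userProb n else 0

open Classical in
/-- Probability `p_0` of a free-load cell: the queue is stable, and empty in equilibrium. -/
def freeProb : ℝ :=
  ∑' n : ℕ, if 𝒩.load n < 1 then 𝒩.userProb n * emptyProb (𝒩.load n).toNNReal else 0

/-- Probability that a base station other than the serving one is transmitting in the slot,
`p_t + (1 - p_t) (1 - p_0)`: the active base stations have intensity `activeProb * φ_b`. -/
def activeProb : ℝ := 𝒩.fullProb + (1 - 𝒩.fullProb) * (1 - 𝒩.freeProb)

end Network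

/-! ### Base stations, fading, SINR -/

/-- The plane. -/
abbrev Plane : Type := EuclideanSpace ℝ (Fin 2)

variable {Ω : Type*}

/-- Number of points (with multiplicity) of the sequence `X` in the set `A`. -/
def count (X : ℕ → Ω → Plane) (A : Set Plane) (ω : Ω) : ℕ∞ := {k | X k ω ∈ A}.encard

/-- The points `X 0, X 1, …` form a homogeneous Poisson point process of intensity `φ`:
the number of points in a set of finite area is Poisson with mean `φ` times the area, and the
numbers of points in disjoint sets are independent. -/
structure IsPoissonProcess [MeasurableSpace Ω] (μ : Measure Ω) (φ : ℝ) (X : ℕ → Ω → Plane) :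
    Prop where
  measurable : ∀ k, Measurable (X k)
  poisson : ∀ A : Set Plane, MeasurableSet A → volume A ≠ ∞ → ∀ n : ℕ,
    μ {ω | count X A ω = n} = poissonMeasure (φ * volume.real A).toNNReal {n}
  indep : ∀ (m : ℕ) (A : Fin m → Set Plane), (∀ i, MeasurableSet (A i)) →
    Pairwise (fun i j => Disjoint (A i) (A j)) → iIndepFun (fun i => count X (A i)) μ

/-- Downlink seen from a typical user at the origin. `X 0, X 1, …` are the base stations, listed
by increasing distance to the user, so that `X 0` is the nearest, that is, the serving one;
`gain k` is the power gain `|h_k|²` of the (Rayleigh) channel from `X k` to the user; `active k`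
says whether `X k`, for `k ≥ 1`, transmits in the slot. The active base stations are an independent
thinning of all base stations, with retention probability `𝒩.activeProb`. -/
structure IsDownlink [MeasurableSpace Ω] (μ : Measure Ω) (𝒩 : Network) (X : ℕ → Ω → Plane)
    (gain : ℕ → Ω → ℝ) (active : ℕ → Ω → Bool) : Prop where
  poisson : IsPoissonProcess μ 𝒩.φb X
  ordered : ∀ᵐ ω ∂μ, Monotone fun k => ‖X k ω‖
  gain_measurable : ∀ k, Measurable (gain k)
  gain_law : ∀ k, μ.map (gain k) = expMeasure 1
  gain_indep : iIndepFun gain μ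
  active_measurable : ∀ k, Measurable (active k)
  active_law : ∀ k, μ {ω | active k ω = true} = ENNReal.ofReal 𝒩.activeProb
  active_indep : iIndepFun active μ
  indep_marks : IndepFun (fun ω k => gain k ω) (fun ω k => active k ω) μ
  indep_points : IndepFun (fun ω k => X k ω) (fun ω => (fun k => gain k ω, fun k => active k ω)) μ

/-- Power received over the channel of gain `g` from a base station at `x`, for path-loss
exponent `β`: `P g |x|^(-β)`. -/
def rxPower (𝒩 : Network) (β : ℝ) (g : ℝ) (x : Plane) : ℝ≥0∞ :=
  ENNReal.ofReal (𝒩.P * g) * ‖x‖ₑ ^ (-β)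

/-- Cumulative interference at a cache-untenable user: all active base stations other than the
serving one interfere. -/
def interference (𝒩 : Network) (β : ℝ) (X : ℕ → Ω → Plane) (gain : ℕ → Ω → ℝ)
    (active : ℕ → Ω → Bool) (ω : Ω) : ℝ≥0∞ :=
  ∑' k : ℕ, if active (k + 1) ω then rxPower 𝒩 β (gain (k + 1) ω) (X (k + 1) ω) else 0

/-- SINR of a cache-untenable user, for noise power `σ2`. -/
def sinr (𝒩 : Network) (β σ2 : ℝ) (X : ℕ → Ω → Plane) (gain : ℕ → Ω → ℝ)
    (active : ℕ → Ω → Bool) (ω : Ω) : ℝ≥0∞ :=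
  rxPower 𝒩 β (gain 0 ω) (X 0 ω) / (interference 𝒩 β X gain active ω + ENNReal.ofReal σ2)

/-- Packet loss rate of a cache-untenable user: the probability that the number of bits
`τ B log₂ (1 + SINR)` transmitted in the slot is smaller than the packet size `T`. -/
def packetLossRate [MeasurableSpace Ω] (μ : Measure Ω) (𝒩 : Network) (β σ2 : ℝ)
    (X : ℕ → Ω → Plane) (gain : ℕ → Ω → ℝ) (active : ℕ → Ω → Bool) : ℝ :=
  μ.real {ω | ((𝒩.τ * 𝒩.B : ℝ) : EReal) *
    (ENNReal.log (1 + sinr 𝒩 β σ2 X gain active ω) / ((Real.log 2 : ℝ) : EReal))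
      < ((𝒩.T : ℝ) : EReal)}

end CacheNet

end

/-! Write `t` for the SINR threshold `Tbar`, `p` for the activity probability, and `R k = φ π ‖X
k‖²`. The loss rate is one minus the probability of `t ≤ SINR`. As the serving gain is exponential,
this success probability is the mean of `exp (-Z)`, where `Z` is the gain needed to reach `t`
(`measure_le_sinr`). Without noise, averaging over the gains and activities leaves the mean `F` of
`∏ w (R k / R 0)` over `k ≥ 1`, where `w u = 1 - p t / (u² + t)` is `pathFactor`
(`measure_le_sinr_zero`).

In the area coordinate the points `R k` have unit intensity on the half-line. Let `W` be
`pathPrimitive`, the primitive of `w` with `W u - u → 0`. Heuristically, given `R 0 = r` the other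
points are Poisson on `(r, ∞)`, so that `F = ∫ exp (-r W 1) dr = 1 / W 1`, and `W 1 = 1 + p √t
arctan √t`.

The proof replaces this conditioning by a sandwich. For a fixed scale `r`, the Laplace functional
gives the mean of `∏ w (R k / r)` over all `k ≥ 0` on the event `a ≤ R 0`, namely `exp (-r W (a /
r))` (`lintegral_void_expNeg`); subtraction restricts it to `a ≤ R 0 < b`. When `R 0` is within a
factor `q` of `r`, monotonicity of `w` compares this product with `w 1 ∏ w (R k / R 0)`, `k ≥ 1`.
Integrating over `dr / r` gives every configuration the same weight `log q`, so `w 1 * F * log q`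
lies between bounds that are both asymptotic to `w 1 (q - 1) / W 1` as `q` decreases to `1`.

The limit of vanishing noise is dominated convergence. The closed form also needs `0 < p ≤ 1`,
obtained from the queue and the cell-size law. -/

noncomputable section

namespace CacheNet

/-! ### The function `exp (-x)` on `[0, ∞]` -/

/-- `exp (-x)` for `x ∈ [0, ∞]`, equal to `0` at `∞`. -/
def expNeg (x : ℝ≥0∞) : ℝ≥0∞ := (EReal.exp (x : EReal))⁻¹

@[simp] theorem expNeg_zero : expNeg 0 = 1 := by simp [expNeg]

@[simp] theorem expNeg_top : expNeg ∞ = 0 := by simp [expNeg]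

theorem expNeg_add (x y : ℝ≥0∞) : expNeg (x + y) = expNeg x * expNeg y := by
  rw [expNeg, EReal.coe_ennreal_add, EReal.exp_add, ENNReal.mul_inv]
  · rfl
  · left; simp
  · right; simp

theorem expNeg_sum {ι : Type*} (s : Finset ι) (f : ι → ℝ≥0∞) :
    expNeg (∑ i ∈ s, f i) = ∏ i ∈ s, expNeg (f i) := by
  classical
  induction s using Finset.induction_on with
  | empty => simp
  | insert a s ha ih => rw [Finset.sum_insert ha, Finset.prod_insert ha, expNeg_add, ih]

theorem expNeg_nat_mul (n : ℕ) (x : ℝ≥0∞) : expNeg (x * n) = expNeg x ^ n := by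
  have := expNeg_sum (Finset.range n) fun _ => x
  simpa [mul_comm] using this

theorem antitone_expNeg : Antitone expNeg := fun _ _ h =>
  ENNReal.inv_le_inv.2 (EReal.exp_monotone (EReal.coe_ennreal_le_coe_ennreal_iff.2 h))

theorem expNeg_le_one (x : ℝ≥0∞) : expNeg x ≤ 1 := by
  simpa using antitone_expNeg (zero_le : 0 ≤ x)

theorem continuous_expNeg : Continuous expNeg :=
  (ENNReal.continuous_exp.comp continuous_coe_ennreal_ereal).inv

@[fun_prop]
theorem measurable_expNeg : Measurable expNeg := continuous_expNeg.measurable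

theorem expNeg_ofReal {x : ℝ} (hx : 0 ≤ x) :
    expNeg (ENNReal.ofReal x) = ENNReal.ofReal (Real.exp (-x)) := by
  rw [expNeg, EReal.coe_ennreal_ofReal, max_eq_left hx, EReal.exp_coe, Real.exp_neg,
    ENNReal.ofReal_inv_of_pos (Real.exp_pos x)]

theorem expNeg_ofReal_neg_log {v : ℝ} (hv : 0 < v) (hv1 : v ≤ 1) :
    expNeg (ENNReal.ofReal (-Real.log v)) = ENNReal.ofReal v := by
  rw [expNeg_ofReal (by linarith [Real.log_nonpos hv.le hv1]), neg_neg, Real.exp_log hv]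

theorem tendsto_expNeg_tsum (f : ℕ → ℝ≥0∞) :
    Tendsto (fun n => ∏ k ∈ Finset.range n, expNeg (f k)) atTop (𝓝 (expNeg (∑' k, f k))) := by
  simp_rw [← expNeg_sum]
  exact (continuous_expNeg.tendsto _).comp (ENNReal.tendsto_nat_tsum f)

/-- Probability generating function of the Poisson law. -/
theorem lintegral_expNeg_poissonMeasure (r : ℝ≥0) (y : ℝ≥0∞) :
    ∫⁻ n : ℕ, expNeg (y * n) ∂poissonMeasure r = expNeg ((1 - expNeg y) * r) := by
  have hy : expNeg y ≠ ∞ := ((expNeg_le_one y).trans_lt ENNReal.one_lt_top).ne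
  obtain ⟨z, hz0, hz⟩ : ∃ z : ℝ, 0 ≤ z ∧ expNeg y = ENNReal.ofReal z :=
    ⟨_, ENNReal.toReal_nonneg, (ENNReal.ofReal_toReal hy).symm⟩
  have hz1 : z ≤ 1 := by
    have := expNeg_le_one y
    rwa [hz, ENNReal.ofReal_le_one] at this
  have hs : HasSum (fun n : ℕ => Real.exp (-r) * r ^ n / n.factorial * z ^ n)
      (Real.exp (-((1 - z) * r))) := by
    have h := (NormedSpace.expSeries_div_hasSum_exp (𝔸 := ℝ) (r * z)).mul_left (Real.exp (-r))
    rw [← Real.exp_eq_exp_ℝ, ← Real.exp_add] at h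
    rw [show -((1 - z) * (r : ℝ)) = -r + r * z by ring]
    refine h.congr_fun fun n => ?_
    rw [mul_pow]; ring
  rw [lintegral_countable']
  have h1 : ∀ n : ℕ, expNeg (y * n) * poissonMeasure r {n}
      = ENNReal.ofReal (Real.exp (-r) * r ^ n / n.factorial * z ^ n) := by
    intro n
    rw [expNeg_nat_mul, hz, poissonMeasure_singleton, ← ENNReal.ofReal_pow hz0,
      ← ENNReal.ofReal_mul (by positivity), mul_comm]
  simp_rw [h1]
  rw [← ENNReal.ofReal_tsum_of_nonneg (fun n => by positivity) hs.summable, hs.tsum_eq, hz,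
    ← ENNReal.ofReal_one, ← ENNReal.ofReal_sub _ hz0, ← ENNReal.ofReal_coe_nnreal,
    ← ENNReal.ofReal_mul (by linarith)]
  exact (expNeg_ofReal (mul_nonneg (sub_nonneg.2 hz1) r.coe_nonneg)).symm

/-! ### Laplace functional of a Poisson process -/

variable {Ω : Type*}

theorem coe_count (X : ℕ → Ω → Plane) (A : Set Plane) (ω : Ω) :
    ((count X A ω : ℕ∞) : ℝ≥0∞) = ∑' k, A.indicator 1 (X k ω) := by
  rw [count, ← ENNReal.tsum_set_one, tsum_subtype {k | X k ω ∈ A} (fun _ => (1 : ℝ≥0∞))]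
  rfl

/-- Points are grouped by the value of `g`, so that only counts of disjoint level sets remain. -/
theorem tsum_simpleFunc_eq (X : ℕ → Ω → Plane) (g : SimpleFunc Plane ℝ≥0∞) (ω : Ω) :
    ∑' k, g (X k ω) = ∑ y ∈ g.range, y * (count X (g ⁻¹' {y}) ω : ℕ∞) := by
  simp_rw [coe_count, ← ENNReal.tsum_mul_left]
  rw [← Summable.tsum_finsetSum fun _ _ => ENNReal.summable]
  refine tsum_congr fun k => ?_
  rw [Finset.sum_eq_single (g (X k ω))]
  · simp
  · intro b _ hb
    simp [Ne.symm hb]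
  · intro h
    exact absurd (SimpleFunc.mem_range_self g _) h

variable [MeasurableSpace Ω] {μ : Measure Ω} {φ : ℝ} {X : ℕ → Ω → Plane}

namespace IsPoissonProcess

theorem measurable_tsum (hX : IsPoissonProcess μ φ X) {g : Plane → ℝ≥0∞} (hg : Measurable g) :
    Measurable fun ω => ∑' k, g (X k ω) :=
  Measurable.tsum fun k => hg.comp (hX.measurable k)

theorem measurable_coe_count (hX : IsPoissonProcess μ φ X) {A : Set Plane}
    (hA : MeasurableSet A) : Measurable fun ω => ((count X A ω : ℕ∞) : ℝ≥0∞) := by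
  simp_rw [coe_count]
  exact hX.measurable_tsum (measurable_one.indicator hA)

theorem measurable_count (hX : IsPoissonProcess μ φ X) {A : Set Plane}
    (hA : MeasurableSet A) : Measurable (count X A) := by
  refine measurable_to_countable' fun n => ?_
  have : count X A ⁻¹' {n} = (fun ω => ((count X A ω : ℕ∞) : ℝ≥0∞)) ⁻¹' {(n : ℝ≥0∞)} := by
    ext ω; simp
  rw [this]
  exact hX.measurable_coe_count hA (measurableSet_singleton _)

theorem map_count [IsProbabilityMeasure μ] (hX : IsPoissonProcess μ φ X) {A : Set Plane}
    (hA : MeasurableSet A) (hA' : volume A ≠ ∞) :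
    μ.map (count X A)
      = (poissonMeasure (φ * volume.real A).toNNReal).map (fun n : ℕ => (n : ℕ∞)) := by
  have hm := hX.measurable_count hA
  have hfin : ∀ n : ℕ, μ.map (count X A) {(n : ℕ∞)}
      = poissonMeasure (φ * volume.real A).toNNReal {n} := by
    intro n
    rw [Measure.map_apply hm (measurableSet_singleton _)]
    exact hX.poisson A hA hA' n
  have hP : IsProbabilityMeasure (μ.map (count X A)) := Measure.isProbabilityMeasure_map hm.aemeasurable
  -- The model prescribes only the finite values of the count; they already carry total mass `1`,
  -- which leaves none for `⊤`.
  have htop : μ.map (count X A) {⊤} = 0 := by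
    have hu : μ.map (count X A) (Set.range fun n : ℕ => (n : ℕ∞)) = 1 := by
      rw [← Set.iUnion_singleton_eq_range, measure_iUnion]
      · simp_rw [hfin]
        have h1 := measure_univ (μ := poissonMeasure (φ * volume.real A).toNNReal)
        rw [← Set.iUnion_of_singleton, measure_iUnion] at h1
        · exact h1
        · intro i j hij; simpa using hij
        · intro i; exact measurableSet_singleton _
      · intro i j hij; simpa using hij
      · intro i; exact measurableSet_singleton _
    have h2 := prob_compl_eq_zero_iff (μ := μ.map (count X A))
      (s := Set.range fun n : ℕ => (n : ℕ∞)) (Set.to_countable _).measurableSet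
    refine measure_mono_null ?_ (h2.2 hu)
    rintro _ rfl
    simp
  refine Measure.ext_of_singleton fun n => ?_
  rw [Measure.map_apply (f := fun n : ℕ => (n : ℕ∞)) Measurable.of_discrete
    (measurableSet_singleton _)]
  induction n using ENat.recTopCoe with
  | top =>
    rw [htop, show (fun n : ℕ => (n : ℕ∞)) ⁻¹' {⊤} = ∅ by ext n; simp, measure_empty]
  | coe n =>
    rw [hfin]
    congr 1
    ext m; simp

theorem lintegral_expNeg_count [IsProbabilityMeasure μ] (hX : IsPoissonProcess μ φ X)
    (hφ : 0 ≤ φ) {A : Set Plane}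
    (hA : MeasurableSet A) (hA' : volume A ≠ ∞) (y : ℝ≥0∞) :
    ∫⁻ ω, expNeg (y * (count X A ω : ℕ∞)) ∂μ
      = expNeg (ENNReal.ofReal φ * ((1 - expNeg y) * volume A)) := by
  have h1 : ∫⁻ ω, expNeg (y * (count X A ω : ℕ∞)) ∂μ
      = ∫⁻ n : ℕ∞, expNeg (y * (n : ℝ≥0∞)) ∂(μ.map (count X A)) := by
    rw [lintegral_map (Measurable.of_discrete) (hX.measurable_count hA)]
  rw [h1, hX.map_count hA hA', lintegral_map (Measurable.of_discrete) (by fun_prop)]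
  simp only [ENat.toENNReal_coe]
  rw [lintegral_expNeg_poissonMeasure]
  congr 1
  have : (((φ * volume.real A).toNNReal : ℝ≥0) : ℝ≥0∞) = ENNReal.ofReal φ * volume A := by
    change ENNReal.ofReal _ = _
    rw [ENNReal.ofReal_mul hφ, Measure.real, ENNReal.ofReal_toReal hA']
  rw [this]
  ring

/-- The level sets are disjoint, hence their counts independent, and the mean factors into Poisson
generating functions. The level set of `0` may have infinite area, but it contributes the factor `1`
on both sides. -/
theorem laplace_simpleFunc [IsProbabilityMeasure μ] (hX : IsPoissonProcess μ φ X) (hφ : 0 ≤ φ)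
    (g : SimpleFunc Plane ℝ≥0∞) (hg : ∀ y, y ≠ 0 → volume (g ⁻¹' {y}) ≠ ∞) :
    ∫⁻ ω, expNeg (∑' k, g (X k ω)) ∂μ
      = expNeg (ENNReal.ofReal φ * ∫⁻ x, (1 - expNeg (g x))) := by
  let e := g.range.equivFin
  let y : Fin g.range.card → ℝ≥0∞ := fun i => (e.symm i).1
  have hsum : ∀ F : ℝ≥0∞ → ℝ≥0∞, ∑ y ∈ g.range, F y = ∑ i, F (y i) := by
    intro F
    rw [← Finset.sum_coe_sort]
    exact (Equiv.sum_comp e.symm fun z => F z.1).symm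
  have hind := hX.indep _ (fun i => g ⁻¹' {y i}) (fun i => g.measurableSet_preimage _) (by
    intro i j hij
    refine Set.disjoint_left.2 fun x hx hx' => hij ?_
    have : y i = y j := by rw [← Set.mem_singleton_iff.1 hx, ← Set.mem_singleton_iff.1 hx']
    exact e.symm.injective (Subtype.ext this))
  simp_rw [tsum_simpleFunc_eq, hsum, expNeg_sum]
  have h2 : ∫⁻ ω, ∏ i, expNeg (y i * (count X (g ⁻¹' {y i}) ω : ℕ∞)) ∂μ
      = ∏ i, ∫⁻ ω, expNeg (y i * (count X (g ⁻¹' {y i}) ω : ℕ∞)) ∂μ := by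
    refine lintegral_prod_eq_prod_lintegral_of_indepFun Finset.univ
      (fun i ω => expNeg (y i * (count X (g ⁻¹' {y i}) ω : ℕ∞))) ?_ ?_
    · exact hind.comp (fun i n => expNeg (y i * ((n : ℕ∞) : ℝ≥0∞)))
        fun i => Measurable.of_discrete
    · intro i
      exact measurable_expNeg.comp
        ((hX.measurable_coe_count (g.measurableSet_preimage _)).const_mul _)
  rw [h2]
  have h3 : ∫⁻ x, (1 - expNeg (g x)) = ∑ i, (1 - expNeg (y i)) * volume (g ⁻¹' {y i}) := by
    rw [← hsum fun y => (1 - expNeg y) * volume (g ⁻¹' {y}),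
      ← SimpleFunc.map_lintegral (fun y => 1 - expNeg y) g, ← SimpleFunc.lintegral_eq_lintegral]
    rfl
  rw [h3, Finset.mul_sum, expNeg_sum]
  refine Finset.prod_congr rfl fun i _ => ?_
  by_cases hy : y i = 0
  · simp [hy]
  · exact hX.lintegral_expNeg_count hφ (g.measurableSet_preimage _) (hg _ hy) _

/-- Laplace functional of a homogeneous Poisson process. -/
theorem laplace [IsProbabilityMeasure μ] (hX : IsPoissonProcess μ φ X) (hφ : 0 ≤ φ)
    {g : Plane → ℝ≥0∞} (hg : Measurable g) :
    ∫⁻ ω, expNeg (∑' k, g (X k ω)) ∂μ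
      = expNeg (ENNReal.ofReal φ * ∫⁻ x, (1 - expNeg (g x))) := by
  -- Cutting off to balls gives the nonzero level sets finite area and keeps the approximation
  -- monotone.
  let G : ℕ → SimpleFunc Plane ℝ≥0∞ := fun n =>
    (SimpleFunc.eapprox g n).restrict (Metric.ball 0 n)
  have hGv : ∀ n x, G n x = (Metric.ball 0 (n : ℝ)).indicator (SimpleFunc.eapprox g n) x :=
    fun n x => by rw [SimpleFunc.restrict_apply _ measurableSet_ball]
  have hmono : ∀ x, Monotone fun n => G n x := by
    intro x m n hmn
    simp only [hGv]
    refine (Set.indicator_le_indicator_of_subset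
      (Metric.ball_subset_ball (Nat.cast_le.2 hmn)) (fun _ => zero_le) x).trans ?_
    exact Set.indicator_le_indicator (SimpleFunc.monotone_eapprox g hmn x)
  have hlim : ∀ x, Tendsto (fun n => G n x) atTop (𝓝 (g x)) := by
    intro x
    refine (SimpleFunc.tendsto_eapprox hg x).congr' ?_
    obtain ⟨N, hN⟩ := exists_nat_gt ‖x‖
    filter_upwards [eventually_ge_atTop N] with n hn
    rw [hGv, Set.indicator_of_mem]
    rw [mem_ball_zero_iff]
    exact hN.trans_le (by exact_mod_cast hn)
  have hfin : ∀ n y, y ≠ 0 → volume (G n ⁻¹' {y}) ≠ ∞ := by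
    intro n y hy
    refine ((measure_mono ?_).trans_lt
      (measure_ball_lt_top (μ := volume) (x := (0 : Plane)) (r := n))).ne
    intro x hx
    by_contra hx'
    have : G n x = y := hx
    rw [hGv, Set.indicator_of_notMem hx'] at this
    exact hy this.symm
  have hL : Tendsto (fun n => ∫⁻ ω, expNeg (∑' k, G n (X k ω)) ∂μ) atTop
      (𝓝 (∫⁻ ω, expNeg (∑' k, g (X k ω)) ∂μ)) := by
    refine tendsto_lintegral_of_dominated_convergence (fun _ => 1) ?_ ?_ ?_ ?_
    · exact fun n => measurable_expNeg.comp (hX.measurable_tsum (G n).measurable)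
    · exact fun n => .of_forall fun ω => expNeg_le_one _
    · simp
    · refine .of_forall fun ω => (continuous_expNeg.tendsto _).comp ?_
      -- As an integral against counting measure, the sum over points falls under monotone
      -- convergence.
      simp_rw [← lintegral_count]
      exact lintegral_tendsto_of_tendsto_of_monotone (fun n => Measurable.of_discrete.aemeasurable)
        (.of_forall fun k => hmono _) (.of_forall fun k => hlim _)
  have hR : Tendsto (fun n => ∫⁻ x, (1 - expNeg (G n x))) atTop
      (𝓝 (∫⁻ x, (1 - expNeg (g x)))) := by
    refine lintegral_tendsto_of_tendsto_of_monotone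
      (fun n => (measurable_const.sub (measurable_expNeg.comp (G n).measurable)).aemeasurable)
      (.of_forall fun x m n hmn => tsub_le_tsub_left (antitone_expNeg (hmono x hmn)) _)
      (.of_forall fun x => ?_)
    exact ENNReal.Tendsto.sub tendsto_const_nhds ((continuous_expNeg.tendsto _).comp (hlim x))
      (.inl ENNReal.one_ne_top)
  refine tendsto_nhds_unique hL ?_
  simp_rw [fun n => hX.laplace_simpleFunc hφ (G n) (hfin n)]
  exact (continuous_expNeg.tendsto _).comp
    (ENNReal.Tendsto.const_mul hR (.inr ENNReal.ofReal_ne_top))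

end IsPoissonProcess

end CacheNet

end

noncomputable section

namespace CacheNet

/-! ### Exponential gains -/

theorem expMeasure_one_eq :
    expMeasure 1 = (volume.restrict (Set.Ici 0)).withDensity
      (fun x : ℝ => ENNReal.ofReal (Real.exp (-x))) := by
  rw [← withDensity_indicator measurableSet_Ici]
  change volume.withDensity (exponentialPDF 1) = _
  congr 1
  ext x
  rw [exponentialPDF_eq, Set.indicator_apply]
  by_cases hx : 0 ≤ x <;> simp [hx]

theorem lintegral_exp_neg_mul_Ici {a : ℝ} (ha : 0 < a) (c : ℝ) :
    ∫⁻ x in Set.Ici c, ENNReal.ofReal (Real.exp (-a * x))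
      = ENNReal.ofReal (Real.exp (-a * c) / a) := by
  rw [setLIntegral_congr Ioi_ae_eq_Ici.symm,
    ← ofReal_integral_eq_lintegral_ofReal (integrableOn_exp_mul_Ioi (neg_neg_of_pos ha) c)
      (.of_forall fun x => (Real.exp_pos _).le), integral_exp_mul_Ioi (neg_neg_of_pos ha), neg_div_neg_eq]

/-- The exponential tail, with `z = ∞` included because the interference is never shown to be
finite. -/
theorem expMeasure_one_le_ofReal (z : ℝ≥0∞) :
    expMeasure 1 {x | z ≤ ENNReal.ofReal x} = expNeg z := by
  have hm : MeasurableSet {x : ℝ | z ≤ ENNReal.ofReal x} :=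
    measurableSet_le measurable_const ENNReal.measurable_ofReal
  have : IsProbabilityMeasure (expMeasure 1) := isProbabilityMeasure_expMeasure one_pos
  induction z using ENNReal.recTopCoe with
  | top => simp
  | coe y =>
    rcases eq_or_ne y 0 with rfl | hy
    · simp
    · have hy' : (0 : ℝ) < y := NNReal.coe_pos.2 (pos_iff_ne_zero.2 hy)
      have hs : {x : ℝ | (y : ℝ≥0∞) ≤ ENNReal.ofReal x} = Set.Ici (y : ℝ) := by
        ext x
        rw [Set.mem_ofPred_eq, Set.mem_Ici, ← ENNReal.ofReal_coe_nnreal]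
        by_cases hx : 0 ≤ x
        · exact ENNReal.ofReal_le_ofReal_iff hx
        · rw [ENNReal.ofReal_of_nonpos (not_le.1 hx).le]
          constructor
          · intro h
            simp [hy] at h
          · intro h; linarith
      rw [hs, expMeasure_one_eq, withDensity_apply _ measurableSet_Ici,
        Measure.restrict_restrict measurableSet_Ici,
        Set.inter_eq_left.2 (Set.Ici_subset_Ici.2 hy'.le)]
      have := lintegral_exp_neg_mul_Ici one_pos (y : ℝ)
      simp only [neg_mul, one_mul, div_one] at this
      rw [this, ← expNeg_ofReal hy'.le, ENNReal.ofReal_coe_nnreal]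

theorem lintegral_expNeg_mul_expMeasure_one {c : ℝ} (hc : 0 ≤ c) :
    ∫⁻ x, expNeg (ENNReal.ofReal c * ENNReal.ofReal x) ∂expMeasure 1
      = ENNReal.ofReal (1 / (1 + c)) := by
  rw [expMeasure_one_eq, lintegral_withDensity_eq_lintegral_mul _ (by fun_prop) (by fun_prop)]
  have := lintegral_exp_neg_mul_Ici (a := 1 + c) (by linarith) 0
  simp only [mul_zero, Real.exp_zero] at this
  rw [← this]
  refine setLIntegral_congr_fun measurableSet_Ici fun x hx => ?_
  have hx : 0 ≤ x := hx
  simp only [Pi.mul_apply]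
  rw [← ENNReal.ofReal_mul hc, expNeg_ofReal (by positivity), ← ENNReal.ofReal_mul (by positivity),
    ← Real.exp_add]
  ring_nf

/-! ### Independent copies -/

variable {Ω : Type*} [MeasurableSpace Ω] {μ : Measure Ω}

/-- In the expectation of a function of two independent random variables, each may be integrated
out on its own. -/
theorem lintegral_comp_eq_of_indepFun [IsFiniteMeasure μ] {α β : Type*} [MeasurableSpace α]
    [MeasurableSpace β] {U : Ω → α} {V : Ω → β} (hU : Measurable U) (hV : Measurable V)
    (h : IndepFun U V μ) {F : α → β → ℝ≥0∞} (hF : Measurable (Function.uncurry F)) :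
    ∫⁻ ω, F (U ω) (V ω) ∂μ = ∫⁻ ω, ∫⁻ ω', F (U ω) (V ω') ∂μ ∂μ := by
  have h1 : ∫⁻ ω, F (U ω) (V ω) ∂μ
      = ∫⁻ z, Function.uncurry F z ∂(μ.map fun ω => (U ω, V ω)) := by
    rw [lintegral_map hF (hU.prodMk hV)]; rfl
  rw [h1, (indepFun_iff_map_prod_eq_prod_map_map hU.aemeasurable hV.aemeasurable).1 h,
    lintegral_prod _ hF.aemeasurable, lintegral_map hF.lintegral_prod_right' hU]
  refine lintegral_congr fun ω => ?_
  exact lintegral_map (hF.comp measurable_prodMk_left) hV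

theorem iIndepFun.indepFun_zero_succ [IsProbabilityMeasure μ] {α : Type*} [MeasurableSpace α]
    {U : ℕ → Ω → α} (hU : ∀ k, Measurable (U k)) (h : iIndepFun U μ) :
    IndepFun (U 0) (fun ω k => U (k + 1) ω) μ := by
  refine IndepFun.indepFun_process (hU 0) (fun k => hU (k + 1)) fun I => ?_
  have hdisj : Disjoint ({0} : Finset ℕ) (I.map ⟨Nat.succ, Nat.succ_injective⟩) := by simp
  exact (h.indepFun_finset _ _ hdisj hU).comp
    (φ := fun z : ({0} : Finset ℕ) → α => z ⟨0, by simp⟩)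
    (ψ := fun (z : (I.map ⟨Nat.succ, Nat.succ_injective⟩ : Finset ℕ) → α) (i : I) =>
      z ⟨i.1 + 1, by simp⟩) (by fun_prop) (by fun_prop)

/-! ### Shannon rate -/

theorem shannonRate_lt_iff {a T : ℝ} (ha : 0 < a) (s : ℝ≥0∞) :
    (a : EReal) * (ENNReal.log (1 + s) / ((Real.log 2 : ℝ) : EReal)) < (T : EReal)
      ↔ s < ENNReal.ofReal ((2 : ℝ) ^ (T / a) - 1) := by
  have h2 : 0 < Real.log 2 := Real.log_pos one_lt_two
  induction s using ENNReal.recTopCoe with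
  | top =>
    rw [add_top, ENNReal.log_top, EReal.top_div_of_pos_ne_top (by exact_mod_cast h2)
      (EReal.coe_ne_top _), EReal.coe_mul_top_of_pos ha]
    simp
  | coe r =>
    have h1 : (1 : ℝ≥0∞) + r = ENNReal.ofReal (1 + r) := by
      rw [ENNReal.ofReal_add zero_le_one r.coe_nonneg, ENNReal.ofReal_one, ENNReal.ofReal_coe_nnreal]
    have hr : (0 : ℝ) < 1 + r := by positivity
    rw [h1, ENNReal.log_ofReal_of_pos hr, ← ENNReal.ofReal_coe_nnreal,
      ENNReal.ofReal_lt_ofReal_iff_of_nonneg r.coe_nonneg, ← EReal.coe_div, ← EReal.coe_mul,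
      EReal.coe_lt_coe_iff, ← lt_div_iff₀' ha, div_lt_iff₀ h2, lt_sub_iff_add_lt',
      ← Real.log_lt_log_iff hr (by positivity), Real.log_rpow two_pos]

end CacheNet

end

noncomputable section

namespace CacheNet

variable {Ω : Type*} [MeasurableSpace Ω] {μ : Measure Ω} {𝒩 : Network} {X : ℕ → Ω → Plane}
  {gain : ℕ → Ω → ℝ} {active : ℕ → Ω → Bool}

/-! ### Averaging over the marks -/

/-- Interference as a function of the base stations, of the gains of the channels from all but
the serving base station, and of the activities. -/
def fieldInterference (𝒩 : Network) (x : ℕ → Plane) (g : ℕ → ℝ) (a : ℕ → Bool) : ℝ≥0∞ :=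
  ∑' k : ℕ, if a (k + 1) then rxPower 𝒩 4 (g k) (x (k + 1)) else 0

/-- The gain of the serving channel has to be at least this large for the SINR to reach `t`. -/
def gainThreshold (𝒩 : Network) (t : ℝ) (σ2 : ℝ) (x : ℕ → Plane) (g : ℕ → ℝ) (a : ℕ → Bool) :
    ℝ≥0∞ :=
  ENNReal.ofReal t * (fieldInterference 𝒩 x g a + ENNReal.ofReal σ2) * ‖x 0‖ₑ ^ 4
    * (ENNReal.ofReal 𝒩.P)⁻¹

@[fun_prop]
theorem measurable_rxPower (𝒩 : Network) (β : ℝ) :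
    Measurable fun z : ℝ × Plane => rxPower 𝒩 β z.1 z.2 := by
  unfold rxPower; fun_prop

theorem measurable_fieldInterference (𝒩 : Network) :
    Measurable fun z : (ℕ → Plane) × (ℕ → ℝ) × (ℕ → Bool) =>
      fieldInterference 𝒩 z.1 z.2.1 z.2.2 := by
  unfold fieldInterference
  refine Measurable.tsum fun k => Measurable.ite ?_ ?_ measurable_const
  · exact (measurableSet_singleton true).preimage
      (f := fun z : (ℕ → Plane) × (ℕ → ℝ) × (ℕ → Bool) => z.2.2 (k + 1)) (by fun_prop)
  · exact (measurable_rxPower 𝒩 4).comp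
      (f := fun z : (ℕ → Plane) × (ℕ → ℝ) × (ℕ → Bool) => (z.2.1 k, z.1 (k + 1))) (by fun_prop)

@[fun_prop]
theorem measurable_gainThreshold (𝒩 : Network) (t σ2 : ℝ) :
    Measurable fun z : (ℕ → Plane) × (ℕ → ℝ) × (ℕ → Bool) =>
      gainThreshold 𝒩 t σ2 z.1 z.2.1 z.2.2 := by
  have := measurable_fieldInterference 𝒩
  unfold gainThreshold; fun_prop

/-- The origin has area `0`, so its count is Poisson of mean `0`. -/
theorem IsPoissonProcess.ae_ne_zero [IsProbabilityMeasure μ] {φ : ℝ}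
    (hX : IsPoissonProcess μ φ X) : ∀ᵐ ω ∂μ, ∀ k, X k ω ≠ 0 := by
  have h := hX.poisson {0} (measurableSet_singleton 0) (by simp) 0
  have h0 : poissonMeasure (φ * volume.real ({0} : Set Plane)).toNNReal {0} = 1 := by
    rw [show volume.real ({0} : Set Plane) = 0 by simp [Measure.real]]
    simp [poissonMeasure_singleton]
  rw [h0] at h
  have hm : MeasurableSet {ω | count X {0} ω = (0 : ℕ)} :=
    hX.measurable_count (measurableSet_singleton 0) (measurableSet_singleton _)
  filter_upwards [(mem_ae_iff_prob_eq_one hm).2 h] with ω hω k hk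
  have hω' : {k | X k ω ∈ ({0} : Set Plane)}.encard = 0 := by simpa [count] using hω
  rw [Set.encard_eq_zero] at hω'
  exact Set.notMem_empty k (hω' ▸ (show k ∈ {k | X k ω ∈ ({0} : Set Plane)} from hk))

/-! ### Success probability as a mean over positions and marks -/

namespace IsDownlink

theorem measure_le_gain (h : IsDownlink μ 𝒩 X gain active) (k : ℕ) (z : ℝ≥0∞) :
    μ {ω | z ≤ ENNReal.ofReal (gain k ω)} = expNeg z := by
  rw [← expMeasure_one_le_ofReal, ← h.gain_law k, Measure.map_apply (h.gain_measurable k)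
    (measurableSet_le measurable_const ENNReal.measurable_ofReal)]
  rfl

theorem ae_gain_pos (h : IsDownlink μ 𝒩 X gain active) : ∀ᵐ ω ∂μ, 0 < gain 0 ω := by
  have h1 : ∀ᵐ x ∂expMeasure 1, (0 : ℝ) < x := by
    rw [expMeasure_one_eq]
    refine (withDensity_absolutelyContinuous _ _).ae_le ?_
    rw [Measure.restrict_congr_set Ioi_ae_eq_Ici.symm]
    exact ae_restrict_mem measurableSet_Ioi
  rw [← h.gain_law 0] at h1
  exact ae_of_ae_map (h.gain_measurable 0).aemeasurable h1

/-- The exponential law has Laplace transform `1 / (1 + c)`, so the mean is `(1 - p) + p / (1 + c)`.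
-/
theorem lintegral_expNeg_gain_active [IsProbabilityMeasure μ] (h : IsDownlink μ 𝒩 X gain active)
    {p : ℝ} (hp0 : 0 ≤ p) (hp1 : p ≤ 1) (hp : p = 𝒩.activeProb)
    (i k : ℕ) {c : ℝ} (hc : 0 ≤ c) :
    ∫⁻ ω', ∫⁻ ω, (if active k ω' then expNeg (ENNReal.ofReal c * ENNReal.ofReal (gain i ω))
      else 1) ∂μ ∂μ = ENNReal.ofReal (1 - p * c / (1 + c)) := by
  have hI : ∫⁻ ω, expNeg (ENNReal.ofReal c * ENNReal.ofReal (gain i ω)) ∂μ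
      = ENNReal.ofReal (1 / (1 + c)) := by
    rw [← lintegral_expNeg_mul_expMeasure_one hc, ← h.gain_law i,
      lintegral_map (by fun_prop) (h.gain_measurable i)]
  have hI' : ∀ ω', ∫⁻ ω, (if active k ω' then
      expNeg (ENNReal.ofReal c * ENNReal.ofReal (gain i ω)) else 1) ∂μ
      = {ω | active k ω = true}.indicator (fun _ => ENNReal.ofReal (1 / (1 + c))) ω'
        + {ω | active k ω = true}ᶜ.indicator (fun _ => 1) ω' := by
    intro ω'
    by_cases ha : active k ω' = true
    · simp [ha, hI]
    · simp [ha]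
  have hm : MeasurableSet {ω | active k ω = true} :=
    h.active_measurable k (measurableSet_singleton true)
  simp_rw [hI']
  rw [lintegral_add_left (measurable_const.indicator hm), lintegral_indicator_const hm,
    lintegral_indicator_const hm.compl, prob_compl_eq_one_sub hm, h.active_law, ← hp, one_mul,
    ← ENNReal.ofReal_mul (by positivity), ← ENNReal.ofReal_one, ← ENNReal.ofReal_sub _ hp0,
    ← ENNReal.ofReal_add (by positivity) (by linarith)]
  congr 1
  field_simp
  ring

/-- By independence the mean is an infinite product of the factors `1 - p c / (1 + c)`. It is
written as `expNeg` of a sum so that it has the form required by the Laplace functional. -/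
theorem lintegral_expNeg_marks [IsProbabilityMeasure μ] (h : IsDownlink μ 𝒩 X gain active)
    {p : ℝ} (hp0 : 0 ≤ p) (hp1 : p ≤ 1) (hp : p = 𝒩.activeProb)
    (c : ℕ → ℝ) (hc : ∀ k, 0 ≤ c k) :
    ∫⁻ ω', ∫⁻ ω, expNeg (∑' k, if active (k + 1) ω' then
        ENNReal.ofReal (c k) * ENNReal.ofReal (gain (k + 1) ω) else 0) ∂μ ∂μ
      = expNeg (∑' k, ENNReal.ofReal (-Real.log (1 - p * c k / (1 + c k)))) := by
  have hgm := h.gain_measurable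
  have ham := h.active_measurable
  let e : ℕ → Bool → ℝ → ℝ≥0∞ := fun k a g =>
    if a then ENNReal.ofReal (c k) * ENNReal.ofReal g else 0
  have he : ∀ k a, Measurable (e k a) := by
    exact fun k a => Measurable.ite (MeasurableSet.const _) (by fun_prop) measurable_const
  have hprod : ∀ n, ∫⁻ ω', ∫⁻ ω, ∏ k ∈ Finset.range n,
      expNeg (e k (active (k + 1) ω') (gain (k + 1) ω)) ∂μ ∂μ
      = ∏ k ∈ Finset.range n, expNeg (ENNReal.ofReal (-Real.log (1 - p * c k / (1 + c k)))) := by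
    intro n
    -- With the activities frozen, the gains factor; the resulting means are functions of
    -- independent activities and factor in turn.
    have h1 : ∀ ω', ∫⁻ ω, ∏ k ∈ Finset.range n,
        expNeg (e k (active (k + 1) ω') (gain (k + 1) ω)) ∂μ
        = ∏ k ∈ Finset.range n, ∫⁻ ω, expNeg (e k (active (k + 1) ω') (gain (k + 1) ω)) ∂μ := by
      intro ω'
      refine lintegral_prod_eq_prod_lintegral_of_indepFun _
        (fun k ω => expNeg (e k (active (k + 1) ω') (gain (k + 1) ω))) ?_ ?_
      · exact (h.gain_indep.precomp Nat.succ_injective).comp _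
          fun k => measurable_expNeg.comp (he k _)
      · exact fun k => measurable_expNeg.comp ((he k _).comp (hgm _))
    simp_rw [h1]
    rw [lintegral_prod_eq_prod_lintegral_of_indepFun (Finset.range n)
      (fun k ω' => ∫⁻ ω, expNeg (e k (active (k + 1) ω') (gain (k + 1) ω)) ∂μ)]
    · refine Finset.prod_congr rfl fun k _ => ?_
      have hck := hc k
      have hlt : p * c k / (1 + c k) < 1 := by
        rw [div_lt_one (by positivity)]
        nlinarith
      rw [expNeg_ofReal_neg_log (by linarith)
        (by linarith [show 0 ≤ p * c k / (1 + c k) by positivity]),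
        ← h.lintegral_expNeg_gain_active hp0 hp1 hp (k + 1) (k + 1) hck]
      refine lintegral_congr fun ω' => lintegral_congr fun ω => ?_
      cases active (k + 1) ω' <;> simp [e]
    · exact (h.active_indep.precomp Nat.succ_injective).comp
        (fun k a => ∫⁻ ω, expNeg (e k a (gain (k + 1) ω)) ∂μ) fun k => Measurable.of_discrete
    · exact fun k => (Measurable.of_discrete
        (f := fun a => ∫⁻ ω, expNeg (e k a (gain (k + 1) ω)) ∂μ)).comp (ham _)
  have hem : ∀ k, Measurable fun z : Ω × Ω =>
      expNeg (e k (active (k + 1) z.1) (gain (k + 1) z.2)) := by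
    intro k
    have h1 : Measurable fun y : Bool × ℝ => e k y.1 y.2 :=
      measurable_from_prod_countable_right (he k)
    exact measurable_expNeg.comp (h1.comp
      (f := fun z : Ω × Ω => (active (k + 1) z.1, gain (k + 1) z.2)) (by fun_prop))
  have hin : ∀ ω', Tendsto (fun n => ∫⁻ ω, ∏ k ∈ Finset.range n,
      expNeg (e k (active (k + 1) ω') (gain (k + 1) ω)) ∂μ) atTop
      (𝓝 (∫⁻ ω, expNeg (∑' k, e k (active (k + 1) ω') (gain (k + 1) ω)) ∂μ)) := by
    intro ω'
    refine tendsto_lintegral_of_dominated_convergence (fun _ => 1) ?_ ?_ ?_ ?_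
    · exact fun n => Finset.measurable_fun_prod _ fun k _ =>
        measurable_expNeg.comp ((he k _).comp (hgm _))
    · exact fun n => .of_forall fun ω => Finset.prod_le_one' fun k _ => expNeg_le_one _
    · simp
    · exact .of_forall fun ω => tendsto_expNeg_tsum _
  have hout : Tendsto (fun n => ∫⁻ ω', ∫⁻ ω, ∏ k ∈ Finset.range n,
      expNeg (e k (active (k + 1) ω') (gain (k + 1) ω)) ∂μ ∂μ) atTop
      (𝓝 (∫⁻ ω', ∫⁻ ω, expNeg (∑' k, e k (active (k + 1) ω') (gain (k + 1) ω)) ∂μ ∂μ)) := by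
    refine tendsto_lintegral_of_dominated_convergence (fun _ => 1) ?_ ?_ ?_ ?_
    · exact fun n => Measurable.lintegral_prod_right' (f := fun z : Ω × Ω =>
        ∏ k ∈ Finset.range n, expNeg (e k (active (k + 1) z.1) (gain (k + 1) z.2)))
        (Finset.measurable_fun_prod _ fun k _ => hem k)
    · refine fun n => .of_forall fun ω' => ?_
      calc _ ≤ ∫⁻ _, 1 ∂μ := lintegral_mono fun ω =>
            Finset.prod_le_one' fun k _ => expNeg_le_one _
        _ = 1 := by simp
    · simp
    · exact .of_forall hin
  refine tendsto_nhds_unique hout ?_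
  simp_rw [hprod]
  exact tendsto_expNeg_tsum _

/-- The packet is received with the probability that the exponential gain of the serving channel
exceeds its threshold. -/
theorem measure_le_sinr [IsProbabilityMeasure μ] (h : IsDownlink μ 𝒩 X gain active) (t σ2 : ℝ) :
    μ {ω | ENNReal.ofReal t ≤ sinr 𝒩 4 σ2 X gain active ω}
      = ∫⁻ ω, expNeg (gainThreshold 𝒩 t σ2 (fun k => X k ω) (fun k => gain (k + 1) ω)
          (fun k => active k ω)) ∂μ := by
  have hXm := h.poisson.measurable
  have hgm := h.gain_measurable
  have ham := h.active_measurable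
  let Z := gainThreshold 𝒩 t σ2
  have hZ : Measurable fun z : (ℕ → Plane) × (ℕ → ℝ) × (ℕ → Bool) => Z z.1 z.2.1 z.2.2 :=
    measurable_gainThreshold 𝒩 t σ2
  have hev : {ω | ENNReal.ofReal t ≤ sinr 𝒩 4 σ2 X gain active ω} =ᵐ[μ]
      {ω | Z (fun k => X k ω) (fun k => gain (k + 1) ω) (fun k => active k ω)
        ≤ ENNReal.ofReal (gain 0 ω)} := by
    filter_upwards [h.ae_gain_pos, h.poisson.ae_ne_zero] with ω hg hx
    refine propext ?_
    change ENNReal.ofReal t ≤ sinr 𝒩 4 σ2 X gain active ω ↔ _ ≤ ENNReal.ofReal (gain 0 ω)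
    have hx0 : ‖X 0 ω‖ₑ ≠ 0 := by simpa using hx 0
    have hxt : ‖X 0 ω‖ₑ ≠ ∞ := enorm_ne_top
    have hP0 : ENNReal.ofReal 𝒩.P ≠ 0 := by simpa using 𝒩.P_pos
    have hPt : ENNReal.ofReal 𝒩.P ≠ ∞ := ENNReal.ofReal_ne_top
    have hrx : rxPower 𝒩 4 (gain 0 ω) (X 0 ω)
        = ENNReal.ofReal 𝒩.P * ENNReal.ofReal (gain 0 ω) / ‖X 0 ω‖ₑ ^ 4 := by
      rw [rxPower, ENNReal.ofReal_mul 𝒩.P_pos.le, ENNReal.rpow_neg, div_eq_mul_inv]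
      norm_cast
    have hx40 : ‖X 0 ω‖ₑ ^ 4 ≠ 0 := pow_ne_zero _ hx0
    have hx4t : ‖X 0 ω‖ₑ ^ 4 ≠ ∞ := ENNReal.pow_ne_top hxt
    have hg0 : ENNReal.ofReal (gain 0 ω) ≠ 0 := by simpa using hg
    -- A numerator that is neither `0` nor `∞` lets the SINR inequality be cleared of its
    -- denominator even when interference plus noise is `0` or `∞`.
    have hrx0 : rxPower 𝒩 4 (gain 0 ω) (X 0 ω) ≠ 0 := by
      rw [hrx]
      exact ENNReal.div_ne_zero.2 ⟨mul_ne_zero hP0 hg0, hx4t⟩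
    have hrxt : rxPower 𝒩 4 (gain 0 ω) (X 0 ω) ≠ ∞ := by
      rw [hrx]
      exact ENNReal.div_ne_top (ENNReal.mul_ne_top hPt ENNReal.ofReal_ne_top) hx40
    rw [sinr, ENNReal.le_div_iff_mul_le (.inr hrx0) (.inr hrxt), hrx,
      ENNReal.le_div_iff_mul_le (.inl hx40) (.inl hx4t)]
    change _ ↔ ENNReal.ofReal t * (interference 𝒩 4 X gain active ω + ENNReal.ofReal σ2)
      * ‖X 0 ω‖ₑ ^ 4 * (ENNReal.ofReal 𝒩.P)⁻¹ ≤ _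
    rw [← div_eq_mul_inv, ENNReal.div_le_iff_le_mul (.inl hP0) (.inl hPt),
      mul_comm (ENNReal.ofReal (gain 0 ω))]
  have hXi := h.indep_points
  have hgi := iIndepFun.indepFun_zero_succ hgm h.gain_indep
  have hmi := h.indep_marks
  rw [measure_congr hev]
  -- the event, seen as a function of the independent variables
  let F : (ℕ → Plane) → (ℕ → ℝ) × (ℕ → Bool) → ℝ≥0∞ := fun x ga =>
    {z : ((ℕ → Plane) × (ℕ → ℝ) × (ℕ → Bool)) × ℝ | Z z.1.1 z.1.2.1 z.1.2.2
      ≤ ENNReal.ofReal z.2}.indicator 1 ((x, (fun k => ga.1 (k + 1)), ga.2), ga.1 0)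
  let F' : (ℕ → Plane) → (ℕ → ℝ) × (ℕ → Bool) → ℝ≥0∞ := fun x ga =>
    expNeg (Z x (fun k => ga.1 (k + 1)) ga.2)
  have hS : MeasurableSet {z : ((ℕ → Plane) × (ℕ → ℝ) × (ℕ → Bool)) × ℝ | Z z.1.1 z.1.2.1 z.1.2.2
      ≤ ENNReal.ofReal z.2} :=
    measurableSet_le (hZ.comp measurable_fst) (by fun_prop)
  have hF : Measurable (Function.uncurry F) := by
    refine (measurable_one.indicator hS).comp
      (f := fun z : (ℕ → Plane) × (ℕ → ℝ) × (ℕ → Bool) =>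
        ((z.1, (fun k => z.2.1 (k + 1)), z.2.2), z.2.1 0)) (by fun_prop)
  have hF' : Measurable (Function.uncurry F') :=
    measurable_expNeg.comp (hZ.comp (f := fun z : (ℕ → Plane) × (ℕ → ℝ) × (ℕ → Bool) =>
        (z.1, (fun k => z.2.1 (k + 1)), z.2.2)) (by fun_prop))
  have hlhs : μ {ω | Z (fun k => X k ω) (fun k => gain (k + 1) ω) (fun k => active k ω)
        ≤ ENNReal.ofReal (gain 0 ω)}
      = ∫⁻ ω, F (fun k => X k ω) (fun k => gain k ω, fun k => active k ω) ∂μ := by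
    have hm : MeasurableSet {ω | Z (fun k => X k ω) (fun k => gain (k + 1) ω)
        (fun k => active k ω) ≤ ENNReal.ofReal (gain 0 ω)} :=
      measurableSet_le (hZ.comp
        (f := fun ω => (fun k => X k ω, fun k => gain (k + 1) ω, fun k => active k ω))
        (by fun_prop)) (by fun_prop)
    rw [← lintegral_indicator_one hm]
    rfl
  have hrhs : ∫⁻ ω, expNeg (Z (fun k => X k ω) (fun k => gain (k + 1) ω)
      (fun k => active k ω)) ∂μ
      = ∫⁻ ω, F' (fun k => X k ω) (fun k => gain k ω, fun k => active k ω) ∂μ := rfl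
  change _ = ∫⁻ ω, expNeg (Z (fun k => X k ω) (fun k => gain (k + 1) ω)
      (fun k => active k ω)) ∂μ
  -- Both sides become nested integrals over positions, then activities, then gains; they now differ
  -- only in how the serving gain enters.
  rw [hlhs, hrhs, lintegral_comp_eq_of_indepFun (by fun_prop) (by fun_prop) hXi hF,
    lintegral_comp_eq_of_indepFun (by fun_prop) (by fun_prop) hXi hF']
  refine lintegral_congr fun ω => ?_
  rw [lintegral_comp_eq_of_indepFun (U := fun ω k => active k ω) (V := fun ω k => gain k ω)
      (F := fun a g => F (fun k => X k ω) (g, a)) (by fun_prop) (by fun_prop) hmi.symm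
      (hF.comp (f := fun z : (ℕ → Bool) × (ℕ → ℝ) => (fun k => X k ω, z.2, z.1)) (by fun_prop)),
    lintegral_comp_eq_of_indepFun (U := fun ω k => active k ω) (V := fun ω k => gain k ω)
      (F := fun a g => F' (fun k => X k ω) (g, a)) (by fun_prop) (by fun_prop) hmi.symm
      (hF'.comp (f := fun z : (ℕ → Bool) × (ℕ → ℝ) => (fun k => X k ω, z.2, z.1)) (by fun_prop))]
  refine lintegral_congr fun ω' => ?_
  let F₀ : (ℕ → ℝ) → ℝ → ℝ≥0∞ := fun g g₀ =>
    {z : ((ℕ → Plane) × (ℕ → ℝ) × (ℕ → Bool)) × ℝ | Z z.1.1 z.1.2.1 z.1.2.2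
      ≤ ENNReal.ofReal z.2}.indicator 1 ((fun k => X k ω, g, fun k => active k ω'), g₀)
  have hF₀ : Measurable (Function.uncurry F₀) :=
    (measurable_one.indicator hS).comp
      (f := fun z : (ℕ → ℝ) × ℝ => ((fun k => X k ω, z.1, fun k => active k ω'), z.2))
      (by fun_prop)
  -- With everything else frozen the threshold is a constant, and the tail of the serving gain turns
  -- the indicator into `expNeg`.
  have hstep := lintegral_comp_eq_of_indepFun (U := fun ω k => gain (k + 1) ω) (V := gain 0)
    (F := F₀) (by fun_prop) (hgm 0) hgi.symm hF₀
  refine hstep.trans (lintegral_congr fun ω'' => ?_)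
  simp only [F', F₀]
  rw [← h.measure_le_gain 0, ← lintegral_indicator_one
    (measurableSet_le measurable_const (by fun_prop))]
  rfl

end IsDownlink

end CacheNet

end

noncomputable section

namespace CacheNet

/-! ### The mean effect of one interferer -/

/-- Mean of the factor `exp (-t g / u²)` that an interferer contributes to the success probability,
where `u` is its squared distance relative to that of the serving base station, `g` its
exponential gain, and `p` the probability that it is active. -/
def pathFactor (p t u : ℝ) : ℝ := 1 - p * t / (u ^ 2 + t)

/-- Antiderivative of `pathFactor p t`, asymptotic to the identity at infinity. -/
def pathPrimitive (p t u : ℝ) : ℝ := u + p * √t * (Real.pi / 2 - Real.arctan (u / √t))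

section PathFactor

variable {p t : ℝ}

/-- For `p = 1` the factor vanishes at `u = 0`, hence the strict bound on `u`. -/
theorem pathFactor_pos (hp1 : p ≤ 1) (ht : 0 < t) {u : ℝ} (hu : 0 < u) : 0 < pathFactor p t u := by
  have : p * t / (u ^ 2 + t) < 1 := by
    rw [div_lt_one (by positivity)]
    nlinarith [sq_pos_of_pos hu]
  rw [pathFactor]; linarith

theorem pathFactor_le_one (hp0 : 0 ≤ p) (ht : 0 < t) (u : ℝ) : pathFactor p t u ≤ 1 := by
  have : 0 ≤ p * t / (u ^ 2 + t) := by positivity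
  rw [pathFactor]; linarith

theorem pathFactor_mono (hp0 : 0 ≤ p) (ht : 0 < t) {u v : ℝ} (hu : 0 ≤ u) (huv : u ≤ v) :
    pathFactor p t u ≤ pathFactor p t v := by
  unfold pathFactor
  gcongr

theorem continuous_pathFactor (ht : 0 < t) : Continuous (pathFactor p t) := by
  unfold pathFactor
  exact continuous_const.sub (continuous_const.div (by fun_prop) fun u => by positivity)

theorem hasDerivAt_pathPrimitive (ht : 0 < t) (u : ℝ) :
    HasDerivAt (pathPrimitive p t) (pathFactor p t u) u := by
  have hs : 0 < √t := Real.sqrt_pos.2 ht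
  have h := (hasDerivAt_id u).add (((((hasDerivAt_id u).div_const √t).arctan).const_sub
    (Real.pi / 2)).const_mul (p * √t))
  refine h.congr_deriv ?_
  have hsq : √t ^ 2 = t := Real.sq_sqrt ht.le
  rw [pathFactor, id, div_pow, hsq]
  field_simp
  rw [add_comm t]
  ring

/-- Mean value bounds for `pathPrimitive`. -/
theorem pathPrimitive_sub_bounds (hp0 : 0 ≤ p) (ht : 0 < t) {u v : ℝ} (hu : 0 ≤ u) (huv : u < v) :
    pathFactor p t u * (v - u) ≤ pathPrimitive p t v - pathPrimitive p t u ∧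
      pathPrimitive p t v - pathPrimitive p t u ≤ pathFactor p t v * (v - u) := by
  obtain ⟨c, hc, hc'⟩ := exists_hasDerivAt_eq_slope (pathPrimitive p t) (pathFactor p t) huv
    (fun x _ => (hasDerivAt_pathPrimitive ht x).continuousAt.continuousWithinAt)
    (fun x _ => hasDerivAt_pathPrimitive ht x)
  have hvu : 0 < v - u := sub_pos.2 huv
  rw [eq_div_iff hvu.ne'] at hc'
  rw [← hc']
  constructor
  · exact mul_le_mul_of_nonneg_right (pathFactor_mono hp0 ht hu hc.1.le) hvu.le
  · exact mul_le_mul_of_nonneg_right (pathFactor_mono hp0 ht (hu.trans hc.1.le) hc.2.le) hvu.le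

theorem pathPrimitive_one (ht : 0 < t) :
    pathPrimitive p t 1 = 1 + p * √t * Real.arctan √t := by
  rw [pathPrimitive, one_div, Real.arctan_inv_of_pos (Real.sqrt_pos.2 ht)]
  ring

end PathFactor

/-- Exponent `-log (pathFactor p t u)` of the effect of one interferer. -/
def pathExponent (p t u : ℝ) : ℝ≥0∞ := ENNReal.ofReal (-Real.log (pathFactor p t u))

@[fun_prop]
theorem measurable_pathExponent (p t : ℝ) : Measurable (pathExponent p t) := by
  unfold pathExponent pathFactor; fun_prop

theorem expNeg_pathExponent {p t u : ℝ} (hp0 : 0 ≤ p) (hp1 : p ≤ 1) (ht : 0 < t) (hu : 0 < u) :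
    expNeg (pathExponent p t u) = ENNReal.ofReal (pathFactor p t u) :=
  expNeg_ofReal_neg_log (pathFactor_pos hp1 ht hu) (pathFactor_le_one hp0 ht u)

theorem pathExponent_anti {p t u v : ℝ} (hp0 : 0 ≤ p) (hp1 : p ≤ 1) (ht : 0 < t) (hu : 0 < u)
    (huv : u ≤ v) : pathExponent p t v ≤ pathExponent p t u :=
  ENNReal.ofReal_le_ofReal (neg_le_neg (Real.log_le_log (pathFactor_pos hp1 ht hu)
    (pathFactor_mono hp0 ht hu.le huv)))

variable {Ω : Type*} [MeasurableSpace Ω] {μ : Measure Ω} {𝒩 : Network} {X : ℕ → Ω → Plane}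
  {gain : ℕ → Ω → ℝ} {active : ℕ → Ω → Bool}

/-- Without noise the transmission power cancels and only ratios of distances remain; this scale
invariance underlies the closed form. -/
theorem gainThreshold_zero_eq (𝒩 : Network) {t : ℝ} (ht : 0 < t) (x : ℕ → Plane)
    (hx : ∀ k, x k ≠ 0) (g : ℕ → ℝ) (a : ℕ → Bool) :
    gainThreshold 𝒩 t 0 x g a = ∑' k, if a (k + 1) then
      ENNReal.ofReal (t * (‖x 0‖ / ‖x (k + 1)‖) ^ 4) * ENNReal.ofReal (g k) else 0 := by
  rw [gainThreshold, ENNReal.ofReal_zero, add_zero, fieldInterference, mul_assoc, mul_assoc,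
    ← ENNReal.tsum_mul_right, ← ENNReal.tsum_mul_left]
  refine tsum_congr fun k => ?_
  cases a (k + 1) with
  | false => simp
  | true =>
    have hP : ENNReal.ofReal 𝒩.P * (ENNReal.ofReal 𝒩.P)⁻¹ = 1 :=
      ENNReal.mul_inv_cancel (by simpa using 𝒩.P_pos) ENNReal.ofReal_ne_top
    have hk : 0 < ‖x (k + 1)‖ := norm_pos_iff.2 (hx _)
    have hpow : ‖x (k + 1)‖ₑ ^ (-4 : ℝ) = (ENNReal.ofReal (‖x (k + 1)‖ ^ 4))⁻¹ := by
      rw [ENNReal.rpow_neg, ← ofReal_norm, ENNReal.ofReal_pow hk.le]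
      norm_cast
    simp only [if_true]
    rw [rxPower, hpow, ENNReal.ofReal_mul 𝒩.P_pos.le, ENNReal.ofReal_mul ht.le, div_pow,
      ENNReal.ofReal_div_of_pos (by positivity), div_eq_mul_inv, ← ofReal_norm,
      ENNReal.ofReal_pow (norm_nonneg (x 0))]
    calc _ = ENNReal.ofReal t * (ENNReal.ofReal ‖x 0‖ ^ 4 *
          (ENNReal.ofReal (‖x (k + 1)‖ ^ 4))⁻¹) * ENNReal.ofReal (g k)
          * (ENNReal.ofReal 𝒩.P * (ENNReal.ofReal 𝒩.P)⁻¹) := by ring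
      _ = _ := by rw [hP, mul_one]

/-! ### Zero noise, vanishing noise, and the loss rate -/

namespace IsDownlink

/-- Without noise, the success probability is a functional of the base stations alone. -/
theorem measure_le_sinr_zero [IsProbabilityMeasure μ] (h : IsDownlink μ 𝒩 X gain active)
    {p : ℝ} (hp0 : 0 ≤ p) (hp1 : p ≤ 1) (hp : p = 𝒩.activeProb) {t : ℝ} (ht : 0 < t) :
    μ {ω | ENNReal.ofReal t ≤ sinr 𝒩 4 0 X gain active ω}
      = ∫⁻ ω, expNeg (∑' k, pathExponent p t (‖X (k + 1) ω‖ ^ 2 / ‖X 0 ω‖ ^ 2)) ∂μ := by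
  have hXm := h.poisson.measurable
  have hgm := h.gain_measurable
  have ham := h.active_measurable
  let F : (ℕ → Plane) → (ℕ → ℝ) × (ℕ → Bool) → ℝ≥0∞ := fun x ga =>
    expNeg (gainThreshold 𝒩 t 0 x (fun k => ga.1 (k + 1)) ga.2)
  have hF : Measurable (Function.uncurry F) :=
    measurable_expNeg.comp ((measurable_gainThreshold 𝒩 t 0).comp
      (f := fun z : (ℕ → Plane) × (ℕ → ℝ) × (ℕ → Bool) =>
        (z.1, (fun k => z.2.1 (k + 1)), z.2.2)) (by fun_prop))
  rw [h.measure_le_sinr]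
  change ∫⁻ ω, F (fun k => X k ω) (fun k => gain k ω, fun k => active k ω) ∂μ = _
  rw [lintegral_comp_eq_of_indepFun (by fun_prop) (by fun_prop) h.indep_points hF]
  refine lintegral_congr_ae ?_
  filter_upwards [h.poisson.ae_ne_zero] with ω hω
  rw [lintegral_comp_eq_of_indepFun (U := fun ω k => active k ω) (V := fun ω k => gain k ω)
      (F := fun a g => F (fun k => X k ω) (g, a)) (by fun_prop) (by fun_prop) h.indep_marks.symm
      (hF.comp (f := fun z : (ℕ → Bool) × (ℕ → ℝ) => (fun k => X k ω, z.2, z.1)) (by fun_prop))]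
  simp only [F, gainThreshold_zero_eq 𝒩 ht _ hω]
  rw [h.lintegral_expNeg_marks hp0 hp1 hp _ fun k => by positivity]
  congr 1
  refine tsum_congr fun k => ?_
  rw [pathExponent, pathFactor]
  have h0 : 0 < ‖X 0 ω‖ := norm_pos_iff.2 (hω 0)
  have hk : 0 < ‖X (k + 1) ω‖ := norm_pos_iff.2 (hω (k + 1))
  -- With `c = t / u²`, the factor `1 - p c / (1 + c)` equals `1 - p t / (u² + t)`.
  congr 4
  field_simp

/-- Dominated convergence with bound `1`: the gain threshold is continuous in the noise even where
the interference is infinite, since its other factors are finite. -/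
theorem tendsto_measure_le_sinr [IsProbabilityMeasure μ] (h : IsDownlink μ 𝒩 X gain active)
    (t : ℝ) : Tendsto (fun σ2 => μ {ω | ENNReal.ofReal t ≤ sinr 𝒩 4 σ2 X gain active ω})
      (𝓝[>] 0) (𝓝 (μ {ω | ENNReal.ofReal t ≤ sinr 𝒩 4 0 X gain active ω})) := by
  have hXm := h.poisson.measurable
  have hgm := h.gain_measurable
  have ham := h.active_measurable
  simp_rw [h.measure_le_sinr]
  refine tendsto_lintegral_filter_of_dominated_convergence (fun _ => 1) ?_ ?_ ?_ ?_
  · exact .of_forall fun σ2 => measurable_expNeg.comp ((measurable_gainThreshold 𝒩 t σ2).comp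
      (f := fun ω => (fun k => X k ω, fun k => gain (k + 1) ω, fun k => active k ω))
      (by fun_prop))
  · exact .of_forall fun σ2 => .of_forall fun ω => expNeg_le_one _
  · simp
  · refine .of_forall fun ω => (continuous_expNeg.tendsto _).comp ?_
    have hP : (ENNReal.ofReal 𝒩.P)⁻¹ ≠ ∞ := ENNReal.inv_ne_top.2 (by simpa using 𝒩.P_pos)
    have hσ : Tendsto ENNReal.ofReal (𝓝[>] 0) (𝓝 (ENNReal.ofReal 0)) :=
      (ENNReal.continuous_ofReal.tendsto 0).mono_left nhdsWithin_le_nhds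
    exact ENNReal.Tendsto.mul_const (ENNReal.Tendsto.mul_const (ENNReal.Tendsto.const_mul
      (tendsto_const_nhds.add hσ) (.inr ENNReal.ofReal_ne_top))
      (.inr (ENNReal.pow_ne_top enorm_ne_top))) (.inr hP)

theorem measurable_sinr (h : IsDownlink μ 𝒩 X gain active) (σ2 : ℝ) :
    Measurable (sinr 𝒩 4 σ2 X gain active) := by
  have hXm := h.poisson.measurable
  have hgm := h.gain_measurable
  have ham := h.active_measurable
  have hI : Measurable (interference 𝒩 4 X gain active) :=
    (measurable_fieldInterference 𝒩).comp
      (f := fun ω => (fun k => X k ω, fun k => gain (k + 1) ω, fun k => active k ω))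
      (by fun_prop)
  have hr : Measurable fun ω => rxPower 𝒩 4 (gain 0 ω) (X 0 ω) :=
    (measurable_rxPower 𝒩 4).comp (f := fun ω => (gain 0 ω, X 0 ω)) (by fun_prop)
  exact hr.div (hI.add_const _)

theorem packetLossRate_eq [IsProbabilityMeasure μ] (h : IsDownlink μ 𝒩 X gain active) (σ2 : ℝ) :
    packetLossRate μ 𝒩 4 σ2 X gain active
      = 1 - μ.real {ω | ENNReal.ofReal ((2 : ℝ) ^ (𝒩.T / (𝒩.τ * 𝒩.B)) - 1)
          ≤ sinr 𝒩 4 σ2 X gain active ω} := by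
  rw [← probReal_compl_eq_one_sub (measurableSet_le measurable_const (h.measurable_sinr σ2)),
    packetLossRate]
  congr 1
  ext ω
  simp only [Set.mem_ofPred_eq, Set.mem_compl_iff, not_le]
  exact shannonRate_lt_iff (mul_pos 𝒩.τ_pos 𝒩.B_pos) _

end IsDownlink

end CacheNet

end

noncomputable section

namespace CacheNet

/-! ### Area coordinates -/

/-- Under the area coordinate `φ π ‖x‖²`, a planar measure of density `φ` becomes Lebesgue measure
on the half-line. -/
theorem map_areaCoordinate {φ : ℝ} (hφ : 0 < φ) :
    (ENNReal.ofReal φ • (volume : Measure Plane)).map (fun x => φ * Real.pi * ‖x‖ ^ 2)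
      = volume.restrict (Set.Ici (0 : ℝ)) := by
  have hm : Measurable fun x : Plane => φ * Real.pi * ‖x‖ ^ 2 := by fun_prop
  -- Sublevel sets are discs of mean count `a`. For `a ≤ 0` the real square root is `0`, and the
  -- disc is empty, as it should be.
  have hball : ∀ a : ℝ, (ENNReal.ofReal φ • (volume : Measure Plane)).map
      (fun x => φ * Real.pi * ‖x‖ ^ 2) (Set.Iio a) = ENNReal.ofReal a := by
    intro a
    rw [Measure.map_apply hm measurableSet_Iio]
    have hpre : (fun x : Plane => φ * Real.pi * ‖x‖ ^ 2) ⁻¹' Set.Iio a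
        = Metric.ball 0 √(a / (φ * Real.pi)) := by
      ext x
      rw [Set.mem_preimage, Set.mem_Iio, mem_ball_zero_iff, Real.lt_sqrt (norm_nonneg x),
        lt_div_iff₀ (by positivity), mul_comm]
    rw [hpre, Measure.smul_apply, EuclideanSpace.volume_ball_fin_two, smul_eq_mul,
      ← ENNReal.ofReal_pow (Real.sqrt_nonneg _)]
    rcases le_or_gt a 0 with ha | ha
    · rw [Real.sqrt_eq_zero_of_nonpos (div_nonpos_of_nonpos_of_nonneg ha (by positivity)),
        ENNReal.ofReal_of_nonpos ha]
      simp
    · rw [Real.sq_sqrt (by positivity), ← ENNReal.ofReal_mul (by positivity),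
        ← ENNReal.ofReal_mul hφ.le]
      congr 1
      field_simp
  symm
  refine Measure.ext_of_Ico _ _ fun a b hab => ?_
  have hd : Set.Ico a b = Set.Iio b \ Set.Iio a := by
    ext x; simp
  rw [Measure.restrict_apply measurableSet_Ico, hd, measure_sdiff (Set.Iio_subset_Iio hab.le)
    measurableSet_Iio.nullMeasurableSet (by rw [hball]; exact ENNReal.ofReal_ne_top), hball, hball,
    ← hd]
  have : Set.Ico a b ∩ Set.Ici 0 = Set.Ico (max a 0) b := by
    ext x; simp only [Set.mem_inter_iff, Set.mem_Ico, Set.mem_Ici, max_le_iff]; tauto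
  rw [this, Real.volume_Ico]
  rcases le_or_gt a 0 with ha | ha
  · simp [ha, ENNReal.ofReal_of_nonpos]
  · rw [max_eq_left ha.le, ENNReal.ofReal_sub _ ha.le]

theorem lintegral_areaCoordinate {φ : ℝ} (hφ : 0 < φ) {F : ℝ → ℝ≥0∞} (hF : Measurable F) :
    ENNReal.ofReal φ * ∫⁻ x : Plane, F (φ * Real.pi * ‖x‖ ^ 2) = ∫⁻ u in Set.Ici 0, F u := by
  rw [← map_areaCoordinate hφ, lintegral_map hF (by fun_prop), lintegral_smul_measure, smul_eq_mul]

variable {p t : ℝ}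

theorem lintegral_one_sub_pathFactor (hp0 : 0 ≤ p) (ht : 0 < t) {a r : ℝ} (hr : 0 < r) :
    ∫⁻ u in Set.Ici a, ENNReal.ofReal (1 - pathFactor p t (u / r))
      = ENNReal.ofReal (r * (p * √t * (Real.pi / 2 - Real.arctan (a / r / √t)))) := by
  -- A primitive of the integrand that vanishes at infinity, by the normalisation of
  -- `pathPrimitive`.
  let H : ℝ → ℝ := fun u => u - r * pathPrimitive p t (u / r)
  have hd : ∀ u, HasDerivAt H (1 - pathFactor p t (u / r)) u := by
    intro u
    have h1 := ((hasDerivAt_pathPrimitive (p := p) ht (u / r)).comp u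
      ((hasDerivAt_id u).div_const r)).const_mul r
    refine ((hasDerivAt_id u).sub h1).congr_deriv ?_
    field_simp
  have hH : H = fun u => -(r * (p * √t * (Real.pi / 2 - Real.arctan (u / r / √t)))) := by
    ext u
    simp only [H, pathPrimitive]
    field_simp
    ring
  have hs : 0 < √t := Real.sqrt_pos.2 ht
  have hlim : Tendsto H atTop (𝓝 (-(r * (p * √t * (Real.pi / 2 - Real.pi / 2))))) := by
    rw [hH]
    have h1 : Tendsto (fun u : ℝ => u / r / √t) atTop atTop :=
      (tendsto_id.atTop_div_const hr).atTop_div_const hs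
    have h2 : Tendsto (fun u : ℝ => Real.arctan (u / r / √t)) atTop (𝓝 (Real.pi / 2)) :=
      (Real.tendsto_arctan_atTop.mono_right nhdsWithin_le_nhds).comp h1
    exact (((tendsto_const_nhds.sub h2).const_mul _).const_mul _).neg
  have hnn : ∀ u ∈ Set.Ioi a, 0 ≤ 1 - pathFactor p t (u / r) := fun u _ =>
    sub_nonneg.2 (pathFactor_le_one hp0 ht _)
  rw [setLIntegral_congr Ioi_ae_eq_Ici.symm, ← ofReal_integral_eq_lintegral_ofReal
    (integrableOn_Ioi_deriv_of_nonneg' (fun u _ => hd u) hnn hlim)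
    (ae_restrict_of_forall_mem measurableSet_Ioi hnn),
    integral_Ioi_of_hasDerivAt_of_nonneg' (fun u _ => hd u) hnn hlim, hH]
  simp

/-- The forbidden interval `[0, a)` contributes its length `a`, and the rest contributes `r W (a /
r) - a`, with `W` for `pathPrimitive`. -/
theorem lintegral_voidPathExponent (hp0 : 0 ≤ p) (hp1 : p ≤ 1) (ht : 0 < t) {a r : ℝ} (ha : 0 < a)
    (hr : 0 < r) :
    ∫⁻ u in Set.Ici 0, (1 - expNeg (if u < a then ∞ else pathExponent p t (u / r)))
      = ENNReal.ofReal (r * pathPrimitive p t (a / r)) := by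
  rw [← Set.Ico_union_Ici_eq_Ici ha.le, lintegral_union measurableSet_Ici
    (Set.disjoint_left.2 fun x hx hx' => absurd hx.2 (not_lt.2 hx')),
    setLIntegral_congr_fun (g := fun _ => 1) measurableSet_Ico (fun u hu => by simp [hu.2]),
    setLIntegral_congr_fun (g := fun u => ENNReal.ofReal (1 - pathFactor p t (u / r)))
      measurableSet_Ici (fun u hu => ?_),
    lintegral_one_sub_pathFactor hp0 ht hr, setLIntegral_one, Real.volume_Ico, sub_zero,
    ← ENNReal.ofReal_add ha.le]
  · congr 1
    rw [pathPrimitive]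
    field_simp
  · refine mul_nonneg hr.le (mul_nonneg (by positivity) ?_)
    linarith [Real.arctan_lt_pi_div_two (a / r / √t)]
  · have hu' : 0 < u / r := div_pos (ha.trans_le hu) hr
    simp only [not_lt.2 (Set.mem_Ici.1 hu), if_false]
    rw [expNeg_pathExponent hp0 hp1 ht hu', ENNReal.ofReal_sub _ (pathFactor_pos hp1 ht hu').le,
      ENNReal.ofReal_one]

end CacheNet

end

noncomputable section

namespace CacheNet

variable {Ω : Type*} [MeasurableSpace Ω] {μ : Measure Ω}

/-! ### The nearest point of a Poisson process -/

section Sandwich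

variable [IsProbabilityMeasure μ] {φ p t : ℝ} {X : ℕ → Ω → Plane}

theorem lintegral_inv_Ioc {c q : ℝ} (hc : 0 < c) (hq : 1 < q) :
    ∫⁻ r in Set.Ioc c (q * c), ENNReal.ofReal r⁻¹ = ENNReal.ofReal (Real.log q) := by
  have hcq : c ≤ q * c := by nlinarith
  have hpos : ∀ r ∈ Set.Ioc c (q * c), 0 ≤ r⁻¹ := fun r hr => inv_nonneg.2 (hc.trans hr.1).le
  have hi : IntervalIntegrable (fun r : ℝ => r⁻¹) volume c (q * c) :=
    intervalIntegral.intervalIntegrable_inv (fun r hr => by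
      rw [Set.uIcc_of_le hcq] at hr
      exact (hc.trans_le hr.1).ne') continuousOn_id
  rw [← ofReal_integral_eq_lintegral_ofReal ((intervalIntegrable_iff_integrableOn_Ioc_of_le hcq).1 hi)
    (ae_restrict_of_forall_mem measurableSet_Ioc hpos), ← intervalIntegral.integral_of_le hcq,
    integral_inv_of_pos hc (by positivity), mul_div_assoc, div_self hc.ne', mul_one]

/-- The scale-invariant average of `𝔼 [Y; c < r ≤ q c]` over `r`. -/
theorem lintegral_inv_mul_lintegral_Ioc {c : Ω → ℝ} (hc : Measurable c)
    (hc0 : ∀ᵐ ω ∂μ, 0 < c ω) {Y : Ω → ℝ≥0∞} (hY : Measurable Y) {q : ℝ} (hq : 1 < q) :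
    ∫⁻ r in Set.Ioi (0 : ℝ), ENNReal.ofReal r⁻¹ *
        ∫⁻ ω, {ω | c ω < r ∧ r ≤ q * c ω}.indicator Y ω ∂μ
      = (∫⁻ ω, Y ω ∂μ) * ENNReal.ofReal (Real.log q) := by
  have hS : MeasurableSet {z : ℝ × Ω | c z.2 < z.1 ∧ z.1 ≤ q * c z.2} :=
    (measurableSet_lt (by fun_prop : Measurable fun z : ℝ × Ω => c z.2) measurable_fst).inter
      (measurableSet_le measurable_fst (by fun_prop : Measurable fun z : ℝ × Ω => q * c z.2))
  have hm : Measurable fun z : ℝ × Ω => ENNReal.ofReal z.1⁻¹ *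
      {z : ℝ × Ω | c z.2 < z.1 ∧ z.1 ≤ q * c z.2}.indicator (fun z => Y z.2) z :=
    (by fun_prop : Measurable fun z : ℝ × Ω => ENNReal.ofReal z.1⁻¹).mul
      ((by fun_prop : Measurable fun z : ℝ × Ω => Y z.2).indicator hS)
  have h1 : ∀ r : ℝ, ENNReal.ofReal r⁻¹ *
      ∫⁻ ω, {ω | c ω < r ∧ r ≤ q * c ω}.indicator Y ω ∂μ
      = ∫⁻ ω, ENNReal.ofReal r⁻¹ *
        {z : ℝ × Ω | c z.2 < z.1 ∧ z.1 ≤ q * c z.2}.indicator (fun z => Y z.2) (r, ω) ∂μ := by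
    intro r
    rw [lintegral_const_mul' _ _ ENNReal.ofReal_ne_top]
    rfl
  simp_rw [h1]
  -- By Tonelli the scale is integrated first: `dr / r` gives `(c, q c]` the mass `log q`, whatever
  -- `c` is.
  rw [lintegral_lintegral_swap hm.aemeasurable, ← lintegral_mul_const' _ _ ENNReal.ofReal_ne_top]
  refine lintegral_congr_ae ?_
  filter_upwards [hc0] with ω hω
  have h2 : ∀ r : ℝ, ENNReal.ofReal r⁻¹ *
      {z : ℝ × Ω | c z.2 < z.1 ∧ z.1 ≤ q * c z.2}.indicator (fun z => Y z.2) (r, ω)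
      = (Set.Ioc (c ω) (q * c ω)).indicator (fun r => Y ω * ENNReal.ofReal r⁻¹) r := by
    intro r
    by_cases hr : c ω < r ∧ r ≤ q * c ω
    · rw [Set.indicator_of_mem (show (r, ω) ∈ {z : ℝ × Ω | c z.2 < z.1 ∧ z.1 ≤ q * c z.2} from hr),
        Set.indicator_of_mem (show r ∈ Set.Ioc (c ω) (q * c ω) from hr), mul_comm]
    · rw [Set.indicator_of_notMem
          (show (r, ω) ∉ {z : ℝ × Ω | c z.2 < z.1 ∧ z.1 ≤ q * c z.2} from hr),
        Set.indicator_of_notMem (show r ∉ Set.Ioc (c ω) (q * c ω) from hr), mul_zero]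
  have hsub : Set.Ioc (c ω) (q * c ω) ⊆ Set.Ioi 0 := fun r hr => hω.trans hr.1
  simp_rw [h2]
  rw [lintegral_indicator measurableSet_Ioc, Measure.restrict_restrict measurableSet_Ioc,
    Set.inter_eq_left.2 hsub, lintegral_const_mul _ (by fun_prop),
    lintegral_inv_Ioc hω hq]

namespace IsPoissonProcess

/-- Laplace functional of the process outside a disc, on the event that the disc is empty.
All radii are measured by the mean number of points in the disc. -/
theorem lintegral_void_expNeg (hX : IsPoissonProcess μ φ X) (hφ : 0 < φ)
    (hmono : ∀ᵐ ω ∂μ, Monotone fun k => ‖X k ω‖) (hp0 : 0 ≤ p) (hp1 : p ≤ 1) (ht : 0 < t)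
    {a r : ℝ} (ha : 0 < a) (hr : 0 < r) :
    ∫⁻ ω, {ω | a ≤ φ * Real.pi * ‖X 0 ω‖ ^ 2}.indicator (fun ω =>
        expNeg (∑' k, pathExponent p t (φ * Real.pi * ‖X k ω‖ ^ 2 / r))) ω ∂μ
      = ENNReal.ofReal (Real.exp (-(r * pathPrimitive p t (a / r)))) := by
  -- The value `∞` makes `expNeg` of the sum vanish as soon as a point lies in the disc, so one
  -- Laplace functional encodes both the void event and the product.
  let F : ℝ → ℝ≥0∞ := fun u => if u < a then ∞ else pathExponent p t (u / r)
  have hF : Measurable F :=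
    Measurable.ite measurableSet_Iio measurable_const (by fun_prop)
  have hnn : 0 ≤ r * pathPrimitive p t (a / r) := by
    refine mul_nonneg hr.le (add_nonneg (by positivity) (mul_nonneg (by positivity) ?_))
    linarith [Real.arctan_lt_pi_div_two (a / r / √t)]
  have h := hX.laplace hφ.le (g := fun x => F (φ * Real.pi * ‖x‖ ^ 2)) (hF.comp (by fun_prop))
  rw [lintegral_areaCoordinate hφ (F := fun u => 1 - expNeg (F u)) (by fun_prop),
    lintegral_voidPathExponent hp0 hp1 ht ha hr, expNeg_ofReal hnn] at h
  rw [← h]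
  refine lintegral_congr_ae ?_
  filter_upwards [hmono] with ω hω
  by_cases h0 : a ≤ φ * Real.pi * ‖X 0 ω‖ ^ 2
  · rw [Set.indicator_of_mem (show ω ∈ {ω | a ≤ φ * Real.pi * ‖X 0 ω‖ ^ 2} from h0)]
    congr 1
    refine tsum_congr fun k => ?_
    have hk : a ≤ φ * Real.pi * ‖X k ω‖ ^ 2 := h0.trans (by
      have : ‖X 0 ω‖ ≤ ‖X k ω‖ := hω (Nat.zero_le k)
      gcongr)
    simp only [F, not_lt.2 hk, if_false]
  · rw [Set.indicator_of_notMem (show ω ∉ {ω | a ≤ φ * Real.pi * ‖X 0 ω‖ ^ 2} from h0)]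
    have : ∑' k, F (φ * Real.pi * ‖X k ω‖ ^ 2) = ∞ :=
      ENNReal.tsum_eq_top_of_eq_top ⟨0, by simp only [F, not_le.1 h0, if_true]⟩
    rw [this, expNeg_top]

/-- The difference of two void events localises the nearest point, in place of conditioning on its
distance. -/
theorem lintegral_annulus_expNeg (hX : IsPoissonProcess μ φ X) (hφ : 0 < φ)
    (hmono : ∀ᵐ ω ∂μ, Monotone fun k => ‖X k ω‖) (hp0 : 0 ≤ p) (hp1 : p ≤ 1) (ht : 0 < t)
    {a b r : ℝ} (ha : 0 < a) (hab : a ≤ b) (hr : 0 < r) :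
    ∫⁻ ω, {ω | a ≤ φ * Real.pi * ‖X 0 ω‖ ^ 2 ∧ φ * Real.pi * ‖X 0 ω‖ ^ 2 < b}.indicator (fun ω =>
        expNeg (∑' k, pathExponent p t (φ * Real.pi * ‖X k ω‖ ^ 2 / r))) ω ∂μ
      = ENNReal.ofReal (Real.exp (-(r * pathPrimitive p t (a / r)))
        - Real.exp (-(r * pathPrimitive p t (b / r)))) := by
  have hXm := hX.measurable
  have hA := hX.lintegral_void_expNeg hφ hmono hp0 hp1 ht ha hr
  have hB := hX.lintegral_void_expNeg hφ hmono hp0 hp1 ht (ha.trans_le hab) hr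
  rw [ENNReal.ofReal_sub _ (Real.exp_pos _).le, ← hA, ← hB]
  refine ENNReal.eq_sub_of_add_eq (by rw [hB]; exact ENNReal.ofReal_ne_top) ?_
  have hY : Measurable fun ω => expNeg (∑' k, pathExponent p t (φ * Real.pi * ‖X k ω‖ ^ 2 / r)) :=
    measurable_expNeg.comp (Measurable.tsum fun k => by fun_prop)
  rw [← lintegral_add_right _ (hY.indicator (measurableSet_le (by fun_prop) (by fun_prop)))]
  refine lintegral_congr fun ω => ?_
  simp only [Set.indicator_apply, Set.mem_ofPred_eq]
  by_cases h1 : b ≤ φ * Real.pi * ‖X 0 ω‖ ^ 2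
  · simp [h1, hab.trans h1, not_lt.2 h1]
  · simp [h1, not_le.1 h1]

end IsPoissonProcess

/-! ### Comparisons and integrals for the sandwich -/

theorem tsum_pathExponent_succ {x : ℕ → ℝ} (hx : 0 < x 0) (hp0 : 0 ≤ p) (hp1 : p ≤ 1) (ht : 0 < t)
    {r : ℝ} (hr : 0 < r) :
    expNeg (∑' k, pathExponent p t (x k / r))
      = ENNReal.ofReal (pathFactor p t (x 0 / r)) *
        expNeg (∑' k, pathExponent p t (x (k + 1) / r)) := by
  rw [tsum_eq_zero_add' ENNReal.summable, expNeg_add, expNeg_pathExponent hp0 hp1 ht (by positivity)]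

/-- A larger reference scale makes every interferer relatively closer. This exchanges the fixed
scale `r` for the random one `R 0`. -/
theorem tsum_pathExponent_anti {x : ℕ → ℝ} (hx : ∀ k, 0 < x k) (hp0 : 0 ≤ p) (hp1 : p ≤ 1)
    (ht : 0 < t) {r s : ℝ} (hr : 0 < r) (hrs : r ≤ s) :
    expNeg (∑' k, pathExponent p t (x (k + 1) / s))
      ≤ expNeg (∑' k, pathExponent p t (x (k + 1) / r)) := by
  refine antitone_expNeg (ENNReal.tsum_le_tsum fun k => ?_)
  have := hx (k + 1)
  exact pathExponent_anti hp0 hp1 ht (div_pos this (hr.trans_le hrs))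
    (div_le_div_of_nonneg_left this.le hr hrs)

/-- Both bounds are `1 + z ≤ exp z`, at `z = y - x` and at `z = x - y`. -/
theorem exp_neg_sub_exp_neg_bounds (x y : ℝ) :
    (y - x) * Real.exp (-y) ≤ Real.exp (-x) - Real.exp (-y) ∧
      Real.exp (-x) - Real.exp (-y) ≤ (y - x) * Real.exp (-x) := by
  have h1 : Real.exp (-x) = Real.exp (y - x) * Real.exp (-y) := by rw [← Real.exp_add]; ring_nf
  have h2 : Real.exp (-y) = Real.exp (x - y) * Real.exp (-x) := by rw [← Real.exp_add]; ring_nf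
  constructor
  · nlinarith [Real.add_one_le_exp (y - x), Real.exp_pos (-y)]
  · nlinarith [Real.add_one_le_exp (x - y), Real.exp_pos (-x)]

theorem lintegral_const_mul_exp_neg_Ioi {b : ℝ} (hb : 0 < b) {C : ℝ} (hC : 0 ≤ C) :
    ∫⁻ r in Set.Ioi (0 : ℝ), ENNReal.ofReal r⁻¹ *
      ENNReal.ofReal (r * C * Real.exp (-(r * b))) = ENNReal.ofReal (C / b) := by
  have h := lintegral_exp_neg_mul_Ici hb 0
  rw [setLIntegral_congr Ioi_ae_eq_Ici.symm] at h
  rw [div_eq_mul_one_div, ENNReal.ofReal_mul hC]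
  simp only [mul_zero, Real.exp_zero] at h
  rw [← h, ← lintegral_const_mul _ (by fun_prop)]
  refine setLIntegral_congr_fun measurableSet_Ioi fun r hr => ?_
  have hr : 0 < r := hr
  rw [← ENNReal.ofReal_mul (by positivity), ← ENNReal.ofReal_mul hC]
  congr 1
  rw [neg_mul, mul_comm b]
  field_simp
end Sandwich

end CacheNet

end

noncomputable section

namespace CacheNet

/-! ### The activity probability -/

theorem emptyProb_nonneg (ρ : ℝ≥0) : 0 ≤ emptyProb ρ :=
  ge_of_tendsto' (tendsto_emptyProb ρ) fun _ => measureReal_nonneg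

/-- A queue that is empty after a slot had no arrivals in that slot. -/
theorem emptyProb_le_exp_neg (ρ : ℝ≥0) : emptyProb ρ ≤ Real.exp (-ρ) := by
  refine le_of_tendsto ((tendsto_add_atTop_iff_nat 1).2 (tendsto_emptyProb ρ))
    (.of_forall fun k => ?_)
  have h : queueLaw ρ (k + 1) {0} ≤ poissonMeasure ρ {0} := by
    rw [← lintegral_indicator_one (measurableSet_singleton 0), lintegral_queueLaw_succ]
    calc _ ≤ ∫⁻ _, poissonMeasure ρ {0} ∂queueLaw ρ k := by
          refine lintegral_mono fun x => ?_
          rw [← lintegral_indicator_one (measurableSet_singleton 0)]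
          refine lintegral_mono fun y => ?_
          simp only [Set.indicator_apply]
          split_ifs <;> simp_all
      _ = poissonMeasure ρ {0} := by simp
  have h2 := ENNReal.toReal_mono (measure_ne_top _ _) h
  have h3 := poissonMeasure_real_singleton ρ 0
  simp only [pow_zero, mul_one, Nat.factorial_zero, Nat.cast_one, div_one] at h3
  exact h2.trans_eq h3

/-! ### Cell occupancy and the range of the activity probability -/

namespace Network

variable (𝒩 : Network)

instance isProbabilityMeasure_cellSize :
    IsProbabilityMeasure (gammaMeasure 3.575 (𝒩.φb * 3.575)) :=
  isProbabilityMeasure_gammaMeasure (by norm_num) (mul_pos 𝒩.φb_pos (by norm_num))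

theorem integrable_userProb (n : ℕ) :
    Integrable (fun s => (poissonMeasure (𝒩.φu * s).toNNReal).real {n})
      (gammaMeasure 3.575 (𝒩.φb * 3.575)) := by
  refine Integrable.of_bound (C := 1) ?_ (.of_forall fun s => ?_)
  · simp_rw [poissonMeasure_real_singleton]
    exact (by fun_prop : Measurable _).aestronglyMeasurable
  · rw [Real.norm_of_nonneg measureReal_nonneg]
    exact measureReal_le_one

/-- The Gamma law charges only positive sizes, and there each Poisson mass is positive. -/
theorem userProb_pos (n : ℕ) : 0 < 𝒩.userProb n := by
  have hae : ∀ᵐ s ∂gammaMeasure 3.575 (𝒩.φb * 3.575), 0 < s := by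
    have hS : ∀ᵐ s ∂gammaMeasure 3.575 (𝒩.φb * 3.575), s ≠ 0 ∧ 0 ≤ s := by
      rw [gammaMeasure]
      refine (ae_withDensity_iff (measurable_gammaPDFReal _ _).ennreal_ofReal).2 ?_
      filter_upwards [(volume : Measure ℝ).ae_ne 0] with s hs h
      refine ⟨hs, ?_⟩
      by_contra hneg
      exact h (gammaPDF_of_neg (not_le.1 hneg))
    filter_upwards [hS] with s hs using lt_of_le_of_ne hs.2 hs.1.symm
  refine lt_of_le_of_ne (integral_nonneg fun s => measureReal_nonneg) fun h0 => ?_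
  have h := (integral_eq_zero_iff_of_nonneg (fun s => measureReal_nonneg)
    (𝒩.integrable_userProb n)).1 h0.symm
  obtain ⟨s, hs, hs'⟩ := (hae.and h).exists
  have hpos := poissonMeasure_real_singleton_pos (r := (𝒩.φu * s).toNNReal) n
    (Real.toNNReal_pos.2 (mul_pos 𝒩.φu_pos hs))
  exact hpos.ne' hs'

theorem sum_userProb_le_one (F : Finset ℕ) : ∑ n ∈ F, 𝒩.userProb n ≤ 1 := by
  simp only [userProb]
  rw [← integral_finsetSum F fun n _ => 𝒩.integrable_userProb n]
  calc _ ≤ ∫ _, (1 : ℝ) ∂gammaMeasure 3.575 (𝒩.φb * 3.575) := by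
        refine integral_mono (integrable_finsetSum F fun n _ => 𝒩.integrable_userProb n)
          (integrable_const 1) fun s => ?_
        dsimp only
        rw [sum_measureReal_singleton]
        exact measureReal_le_one
    _ = 1 := by simp

theorem summable_userProb : Summable 𝒩.userProb :=
  summable_of_sum_le (fun n => (𝒩.userProb_pos n).le) 𝒩.sum_userProb_le_one

theorem tsum_userProb_le_one : ∑' n, 𝒩.userProb n ≤ 1 :=
  𝒩.summable_userProb.tsum_le_of_sum_le 𝒩.sum_userProb_le_one

theorem fullProb_nonneg : 0 ≤ 𝒩.fullProb := by
  refine tsum_nonneg fun n => ?_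
  split_ifs
  exacts [(𝒩.userProb_pos n).le, le_rfl]

theorem fullProb_le_one : 𝒩.fullProb ≤ 1 := by
  have hle : ∀ n, 0 ≤ (if 1 ≤ 𝒩.load n then 𝒩.userProb n else 0) ∧
      (if 1 ≤ 𝒩.load n then 𝒩.userProb n else 0) ≤ 𝒩.userProb n := by
    intro n
    have := (𝒩.userProb_pos n).le
    split_ifs
    exacts [⟨this, le_rfl⟩, ⟨le_rfl, this⟩]
  exact (Summable.tsum_le_tsum (fun n => (hle n).2)
    (𝒩.summable_userProb.of_nonneg_of_le (fun n => (hle n).1) fun n => (hle n).2)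
    𝒩.summable_userProb).trans 𝒩.tsum_userProb_le_one

theorem load_one_pos : 0 < 𝒩.load 1 := by
  have h0 : 0 ≤ 𝒩.hitRatio := Finset.sum_nonneg fun i _ => 𝒩.f_nonneg i
  have h1 : 𝒩.hitRatio ≤ 1 := by
    rw [← 𝒩.f_sum]
    exact Finset.sum_le_sum_of_subset_of_nonneg (Finset.filter_subset _ _)
      fun i _ _ => 𝒩.f_nonneg i
  have h2 : 0 < 1 - 𝒩.α * 𝒩.hitRatio := by nlinarith [𝒩.α_nonneg, 𝒩.α_lt]
  have := 𝒩.reqRate_pos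
  have := 𝒩.τ_pos
  rw [load]
  positivity

theorem freeProb_nonneg : 0 ≤ 𝒩.freeProb := by
  refine tsum_nonneg fun n => ?_
  split_ifs
  exacts [mul_nonneg (𝒩.userProb_pos n).le (emptyProb_nonneg _), le_rfl]

/-- Cells with exactly one user give a strict loss: they have positive probability and positive
load, so they are either unstable or empty with probability below `1`. -/
theorem freeProb_lt_one : 𝒩.freeProb < 1 := by
  have hemp : ∀ ρ : ℝ≥0, emptyProb ρ ≤ 1 := fun ρ =>
    (emptyProb_le_exp_neg ρ).trans (Real.exp_le_one_iff.2 (neg_nonpos.2 ρ.coe_nonneg))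
  have hle : ∀ n, 0 ≤ (if 𝒩.load n < 1 then
        𝒩.userProb n * emptyProb (𝒩.load n).toNNReal else 0) ∧
      (if 𝒩.load n < 1 then 𝒩.userProb n * emptyProb (𝒩.load n).toNNReal else 0)
        ≤ 𝒩.userProb n := by
    intro n
    have h := 𝒩.userProb_pos n
    split_ifs
    · exact ⟨mul_nonneg h.le (emptyProb_nonneg _), mul_le_of_le_one_right h.le (hemp _)⟩
    · exact ⟨le_rfl, h.le⟩
  refine (Summable.tsum_lt_tsum (i := 1) (fun n => (hle n).2) ?_
    (𝒩.summable_userProb.of_nonneg_of_le (fun n => (hle n).1) fun n => (hle n).2)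
    𝒩.summable_userProb).trans_le 𝒩.tsum_userProb_le_one
  have h := 𝒩.userProb_pos 1
  split_ifs
  · refine mul_lt_of_lt_one_right h ((emptyProb_le_exp_neg _).trans_lt ?_)
    rw [Real.exp_lt_one_iff, neg_lt_zero, NNReal.coe_pos, Real.toNNReal_pos]
    exact 𝒩.load_one_pos
  · exact h

theorem activeProb_eq : 𝒩.activeProb = 1 - 𝒩.freeProb + 𝒩.freeProb * 𝒩.fullProb := by
  rw [activeProb]; ring

/-- The closed form inverts this number: at `0`, the convention `0⁻¹ = 0` would give `1` where the
loss rate is `0`. -/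
theorem activeProb_pos : 0 < 𝒩.activeProb := by
  rw [activeProb_eq]
  have := mul_nonneg 𝒩.freeProb_nonneg 𝒩.fullProb_nonneg
  linarith [𝒩.freeProb_lt_one]

theorem activeProb_le_one : 𝒩.activeProb ≤ 1 := by
  rw [activeProb_eq]
  nlinarith [𝒩.freeProb_nonneg, 𝒩.fullProb_le_one]

end Network

end CacheNet

end

noncomputable section

namespace CacheNet

variable {Ω : Type*} [MeasurableSpace Ω] {μ : Measure Ω} [IsProbabilityMeasure μ] {φ p t : ℝ}
  {X : ℕ → Ω → Plane}

/-! ### Interference relative to the nearest point -/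

namespace IsPoissonProcess

/-- On `r ≤ R 0 < q r`, the factor of the nearest point is at least `w 1`, and measuring the others
against `r` instead of `R 0` only raises their factors. The annulus formula and the mean value bound
for `W` then give an upper bound, integrated over `dr / r`. -/
theorem mul_lintegral_nearest_le (hX : IsPoissonProcess μ φ X) (hφ : 0 < φ)
    (hmono : ∀ᵐ ω ∂μ, Monotone fun k => ‖X k ω‖) (hp0 : 0 ≤ p) (hp1 : p ≤ 1) (ht : 0 < t)
    {q : ℝ} (hq : 1 < q) :
    ENNReal.ofReal (pathFactor p t 1) *
        ((∫⁻ ω, expNeg (∑' k, pathExponent p t (‖X (k + 1) ω‖ ^ 2 / ‖X 0 ω‖ ^ 2)) ∂μ)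
          * ENNReal.ofReal (Real.log q))
      ≤ ENNReal.ofReal (pathFactor p t q * (q - 1) / pathPrimitive p t 1) := by
  have hXm := hX.measurable
  have hb : 0 < pathPrimitive p t 1 := by rw [pathPrimitive_one ht]; positivity
  have hw1 := pathFactor_pos (p := p) hp1 ht one_pos
  have hq0 : 0 < q := one_pos.trans hq
  have hwq := pathFactor_pos (p := p) hp1 ht hq0
  let R : ℕ → Ω → ℝ := fun k ω => φ * Real.pi * ‖X k ω‖ ^ 2
  let Y : Ω → ℝ≥0∞ := fun ω =>
    expNeg (∑' k, pathExponent p t (‖X (k + 1) ω‖ ^ 2 / ‖X 0 ω‖ ^ 2))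
  have hR : ∀ᵐ ω ∂μ, ∀ k, 0 < R k ω := by
    filter_upwards [hX.ae_ne_zero] with ω hω k
    have := norm_pos_iff.2 (hω k)
    positivity
  have hRm : Measurable (R 0) := by fun_prop
  have hY : Measurable Y := measurable_expNeg.comp (Measurable.tsum fun k => by fun_prop)
  -- The choice `c = R 0 / q` makes the window `R 0 / q < r ≤ R 0`, that is, `r ≤ R 0 < q r`.
  rw [← lintegral_inv_mul_lintegral_Ioc (c := fun ω => R 0 ω / q) (hRm.div_const q)
    (hR.mono fun ω hω => div_pos (hω 0) hq0) hY hq,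
    ← lintegral_const_mul' _ _ ENNReal.ofReal_ne_top,
    ← lintegral_const_mul_exp_neg_Ioi hb (mul_nonneg hwq.le (by linarith))]
  refine setLIntegral_mono' measurableSet_Ioi fun r hr => ?_
  have hr : 0 < r := hr
  rw [mul_left_comm (ENNReal.ofReal (pathFactor p t 1))]
  refine mul_le_mul_right ?_ _
  rw [← lintegral_const_mul' _ _ ENNReal.ofReal_ne_top]
  have hJ := hX.lintegral_annulus_expNeg hφ hmono hp0 hp1 ht hr
    (show r ≤ q * r by nlinarith) hr
  rw [div_self hr.ne', mul_div_assoc, div_self hr.ne', mul_one] at hJ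
  refine le_trans ?_ (hJ.trans_le (ENNReal.ofReal_le_ofReal ?_))
  · refine lintegral_mono_ae ?_
    filter_upwards [hR] with ω hω
    by_cases h : R 0 ω / q < r ∧ r ≤ q * (R 0 ω / q)
    · have h1 : r ≤ R 0 ω := by rw [mul_div_cancel₀ _ hq0.ne'] at h; exact h.2
      have h2 : R 0 ω < q * r := by rw [mul_comm]; exact (div_lt_iff₀ hq0).1 h.1
      rw [Set.indicator_of_mem (show ω ∈ {ω | R 0 ω / q < r ∧ r ≤ q * (R 0 ω / q)} from h),
        Set.indicator_of_mem (show ω ∈ {ω | r ≤ φ * Real.pi * ‖X 0 ω‖ ^ 2 ∧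
          φ * Real.pi * ‖X 0 ω‖ ^ 2 < q * r} from ⟨h1, h2⟩),
        tsum_pathExponent_succ (x := fun k => R k ω) (hω 0) hp0 hp1 ht hr]
      refine mul_le_mul' (ENNReal.ofReal_le_ofReal
        (pathFactor_mono hp0 ht zero_le_one ((one_le_div hr).2 h1))) ?_
      refine le_trans (le_of_eq ?_) (tsum_pathExponent_anti hω hp0 hp1 ht hr h1)
      simp only [Y, R]
      congr 1
      refine tsum_congr fun k => ?_
      rw [mul_div_mul_left _ _ (by positivity)]
    · rw [Set.indicator_of_notMem (show ω ∉ {ω | R 0 ω / q < r ∧ r ≤ q * (R 0 ω / q)} from h),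
        mul_zero]
      exact zero_le
  · refine (exp_neg_sub_exp_neg_bounds _ _).2.trans
      (mul_le_mul_of_nonneg_right ?_ (Real.exp_pos _).le)
    rw [← mul_sub]
    exact mul_le_mul_of_nonneg_left (pathPrimitive_sub_bounds hp0 ht zero_le_one hq).2 hr.le

/-- The mirror image: on `q⁻¹ r ≤ R 0 < r` all comparisons reverse. The outer radius is now `r`, so
the exponential is again `exp (-r W 1)`. -/
theorem le_mul_lintegral_nearest (hX : IsPoissonProcess μ φ X) (hφ : 0 < φ)
    (hmono : ∀ᵐ ω ∂μ, Monotone fun k => ‖X k ω‖) (hp0 : 0 ≤ p) (hp1 : p ≤ 1) (ht : 0 < t)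
    {q : ℝ} (hq : 1 < q) :
    ENNReal.ofReal (pathFactor p t q⁻¹ * (1 - q⁻¹) / pathPrimitive p t 1)
      ≤ ENNReal.ofReal (pathFactor p t 1) *
        ((∫⁻ ω, expNeg (∑' k, pathExponent p t (‖X (k + 1) ω‖ ^ 2 / ‖X 0 ω‖ ^ 2)) ∂μ)
          * ENNReal.ofReal (Real.log q)) := by
  have hXm := hX.measurable
  have hb : 0 < pathPrimitive p t 1 := by rw [pathPrimitive_one ht]; positivity
  have hw1 := pathFactor_pos (p := p) hp1 ht one_pos
  have hq0 : 0 < q := one_pos.trans hq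
  have hq1 : q⁻¹ < 1 := inv_lt_one_of_one_lt₀ hq
  have hwq := pathFactor_pos (p := p) hp1 ht (inv_pos.2 hq0)
  let R : ℕ → Ω → ℝ := fun k ω => φ * Real.pi * ‖X k ω‖ ^ 2
  let Y : Ω → ℝ≥0∞ := fun ω =>
    expNeg (∑' k, pathExponent p t (‖X (k + 1) ω‖ ^ 2 / ‖X 0 ω‖ ^ 2))
  have hR : ∀ᵐ ω ∂μ, ∀ k, 0 < R k ω := by
    filter_upwards [hX.ae_ne_zero] with ω hω k
    have := norm_pos_iff.2 (hω k)
    positivity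
  have hRm : Measurable (R 0) := by fun_prop
  have hY : Measurable Y := measurable_expNeg.comp (Measurable.tsum fun k => by fun_prop)
  rw [← lintegral_inv_mul_lintegral_Ioc (c := R 0) hRm (hR.mono fun ω hω => hω 0) hY hq,
    ← lintegral_const_mul' _ _ ENNReal.ofReal_ne_top,
    ← lintegral_const_mul_exp_neg_Ioi hb (mul_nonneg hwq.le (by linarith))]
  refine setLIntegral_mono' measurableSet_Ioi fun r hr => ?_
  have hr : 0 < r := hr
  rw [mul_left_comm (ENNReal.ofReal (pathFactor p t 1))]
  refine mul_le_mul_right ?_ _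
  rw [← lintegral_const_mul' _ _ ENNReal.ofReal_ne_top]
  have hJ := hX.lintegral_annulus_expNeg hφ hmono hp0 hp1 ht (mul_pos (inv_pos.2 hq0) hr)
    (show q⁻¹ * r ≤ r by nlinarith) hr
  rw [mul_div_assoc, div_self hr.ne', mul_one] at hJ
  refine le_trans (ENNReal.ofReal_le_ofReal ?_) (hJ.symm.trans_le ?_)
  · refine (mul_le_mul_of_nonneg_right ?_ (Real.exp_pos _).le).trans
      (exp_neg_sub_exp_neg_bounds _ _).1
    rw [← mul_sub]
    exact mul_le_mul_of_nonneg_left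
      (pathPrimitive_sub_bounds hp0 ht (inv_pos.2 hq0).le hq1).1 hr.le
  · refine lintegral_mono_ae ?_
    filter_upwards [hR] with ω hω
    by_cases h : q⁻¹ * r ≤ φ * Real.pi * ‖X 0 ω‖ ^ 2 ∧ φ * Real.pi * ‖X 0 ω‖ ^ 2 < r
    · have h1 : R 0 ω < r := h.2
      have h2 : r ≤ q * R 0 ω := (inv_mul_le_iff₀ hq0).1 h.1
      rw [Set.indicator_of_mem (show ω ∈ {ω | R 0 ω < r ∧ r ≤ q * R 0 ω} from ⟨h1, h2⟩),
        Set.indicator_of_mem (show ω ∈ {ω | q⁻¹ * r ≤ φ * Real.pi * ‖X 0 ω‖ ^ 2 ∧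
          φ * Real.pi * ‖X 0 ω‖ ^ 2 < r} from h),
        tsum_pathExponent_succ (x := fun k => R k ω) (hω 0) hp0 hp1 ht hr]
      refine mul_le_mul' (ENNReal.ofReal_le_ofReal
        (pathFactor_mono hp0 ht (div_pos (hω 0) hr).le ((div_le_one hr).2 h1.le))) ?_
      refine le_trans (tsum_pathExponent_anti hω hp0 hp1 ht (hω 0) h1.le) (le_of_eq ?_)
      simp only [Y, R]
      congr 1
      refine tsum_congr fun k => ?_
      rw [mul_div_mul_left _ _ (by positivity)]
    · rw [Set.indicator_of_notMem (show ω ∉ {ω | q⁻¹ * r ≤ φ * Real.pi * ‖X 0 ω‖ ^ 2 ∧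
          φ * Real.pi * ‖X 0 ω‖ ^ 2 < r} from h)]
      exact zero_le

theorem toReal_lintegral_nearest (hX : IsPoissonProcess μ φ X) (hφ : 0 < φ)
    (hmono : ∀ᵐ ω ∂μ, Monotone fun k => ‖X k ω‖) (hp0 : 0 ≤ p) (hp1 : p ≤ 1) (ht : 0 < t) :
    (∫⁻ ω, expNeg (∑' k, pathExponent p t (‖X (k + 1) ω‖ ^ 2 / ‖X 0 ω‖ ^ 2)) ∂μ).toReal
      = 1 / (1 + p * √t * Real.arctan √t) := by
  have hU := fun q hq => hX.mul_lintegral_nearest_le hφ hmono hp0 hp1 ht (q := q) hq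
  have hL := fun q hq => hX.le_mul_lintegral_nearest hφ hmono hp0 hp1 ht (q := q) hq
  rw [← pathPrimitive_one (p := p) ht]
  have hb : 0 < pathPrimitive p t 1 := by rw [pathPrimitive_one ht]; positivity
  have hw1 := pathFactor_pos (p := p) hp1 ht one_pos
  set b := pathPrimitive p t 1
  have hfin : ∫⁻ ω, expNeg (∑' k, pathExponent p t (‖X (k + 1) ω‖ ^ 2 / ‖X 0 ω‖ ^ 2)) ∂μ ≠ ∞ := by
    refine ne_top_of_le_ne_top ENNReal.one_ne_top ?_
    calc _ ≤ ∫⁻ _, 1 ∂μ := lintegral_mono fun ω => expNeg_le_one _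
      _ = 1 := by simp
  obtain ⟨F, hF0, hF⟩ : ∃ F : ℝ, 0 ≤ F ∧
      ∫⁻ ω, expNeg (∑' k, pathExponent p t (‖X (k + 1) ω‖ ^ 2 / ‖X 0 ω‖ ^ 2)) ∂μ
        = ENNReal.ofReal F :=
    ⟨_, ENNReal.toReal_nonneg, (ENNReal.ofReal_toReal hfin).symm⟩
  rw [hF] at hU hL ⊢
  rw [ENNReal.toReal_ofReal hF0]
  -- The logarithm is removed by `1 - q⁻¹ ≤ log q` here and by `log q ≤ q - 1` in the lower bound;
  -- both bounds then tend to `w 1 / b` as `q → 1`.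
  have hU' : ∀ q : ℝ, 1 < q → pathFactor p t 1 * F ≤ q * pathFactor p t q / b := by
    intro q hq
    have hq0 : 0 < q := one_pos.trans hq
    have hwq := pathFactor_pos (p := p) hp1 ht hq0
    have h := hU q hq
    rw [← ENNReal.ofReal_mul hF0, ← ENNReal.ofReal_mul hw1.le, ENNReal.ofReal_le_ofReal_iff
      (div_nonneg (mul_nonneg hwq.le (by linarith)) hb.le), mul_div_right_comm] at h
    have hlog := Real.one_sub_inv_le_log_of_pos hq0
    have h2 : pathFactor p t 1 * (F * (1 - q⁻¹)) ≤ pathFactor p t q / b * (q - 1) :=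
      le_trans (by gcongr) h
    have h3 : pathFactor p t q / b * (q - 1) = q * pathFactor p t q / b * (1 - q⁻¹) := by
      field_simp
    rw [h3, ← mul_assoc] at h2
    exact le_of_mul_le_mul_right h2 (sub_pos.2 (inv_lt_one_of_one_lt₀ hq))
  have hL' : ∀ q : ℝ, 1 < q → q⁻¹ * pathFactor p t q⁻¹ / b ≤ pathFactor p t 1 * F := by
    intro q hq
    have hq0 : 0 < q := one_pos.trans hq
    have hwq := pathFactor_pos (p := p) hp1 ht (inv_pos.2 hq0)
    have h := hL q hq
    have hlog0 := Real.log_pos hq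
    rw [← ENNReal.ofReal_mul hF0, ← ENNReal.ofReal_mul hw1.le, ENNReal.ofReal_le_ofReal_iff
      (by positivity), mul_div_right_comm] at h
    have hlog := Real.log_le_sub_one_of_pos hq0
    have h2 : pathFactor p t q⁻¹ / b * (1 - q⁻¹) ≤ pathFactor p t 1 * (F * (q - 1)) :=
      h.trans (by gcongr)
    have h3 : pathFactor p t q⁻¹ / b * (1 - q⁻¹) = q⁻¹ * pathFactor p t q⁻¹ / b * (q - 1) := by
      field_simp
    rw [h3, ← mul_assoc] at h2
    exact le_of_mul_le_mul_right h2 (sub_pos.2 hq)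
  have hc := continuous_pathFactor (p := p) ht
  have hlim : Tendsto (fun q : ℝ => q * pathFactor p t q / b) (𝓝 1) (𝓝 (pathFactor p t 1 / b)) := by
    have : Continuous fun q : ℝ => q * pathFactor p t q / b := by fun_prop
    simpa using this.tendsto 1
  have hinv : Tendsto (fun q : ℝ => q⁻¹) (𝓝 1) (𝓝 1) := by
    simpa using tendsto_inv₀ (one_ne_zero (α := ℝ))
  have h1 : pathFactor p t 1 * F ≤ pathFactor p t 1 / b :=
    ge_of_tendsto (hlim.mono_left (nhdsWithin_le_nhds (s := Set.Ioi 1)))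
      (eventually_nhdsWithin_of_forall hU')
  have h2 : pathFactor p t 1 / b ≤ pathFactor p t 1 * F :=
    le_of_tendsto ((hlim.comp hinv).mono_left (nhdsWithin_le_nhds (s := Set.Ioi 1)))
      (eventually_nhdsWithin_of_forall hL')
  have h3 := le_antisymm h1 h2
  rw [div_eq_mul_one_div] at h3
  exact mul_left_cancel₀ hw1.ne' h3

end IsPoissonProcess

end CacheNet

end

/-! ### The closed form of the loss rate -/

theorem corollary1 {Ω : Type*} [MeasurableSpace Ω] (μ : MeasureTheory.Measure Ω)
    [MeasureTheory.IsProbabilityMeasure μ] (𝒩 : CacheNet.Network)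
    (X : ℕ → Ω → CacheNet.Plane) (gain : ℕ → Ω → ℝ) (active : ℕ → Ω → Bool)
    (hmodel : CacheNet.IsDownlink μ 𝒩 X gain active)
    (Tbar : ℝ) (hTbar : Tbar = (2 : ℝ) ^ (𝒩.T / (𝒩.τ * 𝒩.B)) - 1)
    (L : ℝ)
    (hL : L = 1 / (((1 - 𝒩.freeProb + 𝒩.freeProb * 𝒩.fullProb)
      * √Tbar * Real.arctan (√Tbar))⁻¹ + 1)) :
    CacheNet.packetLossRate μ 𝒩 4 0 X gain active = L ∧
      Filter.Tendsto (fun σ2 : ℝ => CacheNet.packetLossRate μ 𝒩 4 σ2 X gain active)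
        (nhdsWithin 0 (Set.Ioi 0)) (nhds L) := by
  have hp0 := 𝒩.activeProb_pos
  have ht : 0 < Tbar := by
    rw [hTbar, sub_pos]
    exact Real.one_lt_rpow one_lt_two (div_pos 𝒩.T_pos (mul_pos 𝒩.τ_pos 𝒩.B_pos))
  have hs : 0 < √Tbar := Real.sqrt_pos.2 ht
  have ha : 0 < Real.arctan √Tbar := Real.arctan_pos.2 hs
  have hloss := fun σ2 => hmodel.packetLossRate_eq σ2
  rw [← hTbar] at hloss
  have hzero : CacheNet.packetLossRate μ 𝒩 4 0 X gain active = L := by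
    rw [hloss, MeasureTheory.Measure.real,
      hmodel.measure_le_sinr_zero hp0.le 𝒩.activeProb_le_one rfl ht,
      hmodel.poisson.toReal_lintegral_nearest 𝒩.φb_pos hmodel.ordered hp0.le
        𝒩.activeProb_le_one ht, hL, ← 𝒩.activeProb_eq]
    -- With `A = p √t arctan √t > 0`, this is `1 - 1 / (1 + A) = 1 / (A⁻¹ + 1)`.
    field_simp
    ring
  refine ⟨hzero, ?_⟩
  rw [← hzero]
  simp_rw [hloss]
  exact tendsto_const_nhds.sub ((ENNReal.tendsto_toReal (MeasureTheory.measure_ne_top _ _)).comp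
    (hmodel.tendsto_measure_le_sinr Tbar))
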